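/- Let $p\ge 4$ be even and put $m=\frac p2-1$, $n=\frac p2$, $N=n+1$, $l=\frac{m(m-1)}2$, $s=1+l+\frac{n(n+1)}2$. Vectors lie in $\mathbb R^s$, $\odot$ and powers of vectors are componentwise, $u\times^1A=A^\top u$, $\mathbf 1=(1,\dots,1)^\top$, and $e_i$ is the $i$-th standard basis vector. **Definitions.** For $A\in\mathbb R^{s\times s}$ and $b,c\in\mathbb R^s$ let $q_k=Ac^{k}-\frac1{k+1}c^{k+1}$ and $d_k=(b\odot c^k)\times^1A-\frac1{k+1}\,b\odot(\mathbf 1-c^{k+1})$, let $\Phi_1=\operatorname{span}\{\mathbf 1,c\}$, $Q_0=D_0=\{0\}$, and $$Q_k=\operatorname{span}\{q_{k-1},\,AQ_{k-1},\,Q_{k-1}\odot\Phi_1\},\qquad D_k=\operatorname{span}\{d_{k-1},\,D_{k-1}\times^1A,\,D_{k-1}\odot\Phi_1\}\qquad(k\ge1).$$ Let $V_l$, $V_l^*$, $V_l^0$ be the spaces of vectors vanishing outside the coordinates $\{1,l+2,\dots,s\}$, $\{2,\dots,l+1\}$, $\{l+2,\dots,s\}$, respectively. A node cluster is a set $S(\xi)=\{i\in\{l+2,\dots,s\}:c_i=\xi\}$,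 and $d$ satisfies the cluster condition if $\sum_{i\in S(\xi)}d_i=0$ for every $\xi$. A tableau $(A,b,c)$ is explicit if $A$ is strictly lower triangular and $A\mathbf 1=c$; it has order $p$ if $\phi(t)=1/\gamma(t)$ for every rooted tree $t$ with at most $p$ vertices, where $\phi(t)=b\cdot\Phi(t)$, $\Phi([t_1\cdots t_k])=\bigodot_iA\Phi(t_i)$ (so $\Phi(\bullet)=\mathbf 1$), and $\gamma$ is the density, $\gamma([t_1\cdots t_k])=|t|\prod_i\gamma(t_i)$. **Construction.** Let $0=x_1<\dots<x_N=1$ and $w_1,\dots,w_N$ be the nodes and weights of the $N$-point Gauss–Lobatto rule on $[0,1]$. *Nodes.* $c_1=x_1$; $c_s=x_N$; $c_{l+1+r}=x_{N-r}$ for $1\le r\le N-2$ (ghost stages); $c_{s-1-j(j+1)/2+r}=x_{N-r}$ for $1\le r\le j\le N-2$ (the $j$-th $D$-group); for $1\le g\le m-1$ the nodes $c_i$ with $\frac{g(g-1)}2+2\le i\le\frac{g(g+1)}2+1$ (the $g$-th $Q$-group) are free, subject to being nonzero and pairwise distinct within the group. *Weights.* $b\in V_l$, $b_1=w_1$, $b_s=w_N$,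 and $\sum_{i\in S(x_j)}b_i=w_j$ for $2\le j\le N-1$. *Matrix.* Let $\varepsilon_{j,r}=e_{s-1-j(j+1)/2+r}-e_{l+1+r}$, $W^D_k=\operatorname{span}\{\varepsilon_{j,r}:1\le r\le j\le k-1\}$ and $W^Q_k=\operatorname{span}\{e_i:2\le i\le\frac{k(k-1)}2+1\}$. The entries of $A$ vanish outside the positions $(i,j)$ of the following sets: $\{i=s,\ l+2\le j\le s-1\}$; $\{s-1-\frac{k(k-1)}2<i\le s-1-\frac{(k-1)(k-2)}2,\ l+2\le j\le s-1-\frac{k(k-1)}2\}$ for $2\le k\le n$; $\{2\le i\le s,\ j=1\}$; $\{\frac{k(k-1)}2+2\le i\le s,\ \frac{(k-1)(k-2)}2+2\le j\le\frac{k(k-1)}2+1\}$ for $2\le k\le m$. The entries at these positions are determined by the $D$-system $$d_{k-1}\cdot v=0\ (1\le k\le n),\qquad (u\times^1A)\cdot v=0\ (2\le k\le n,\ u\in W^D_{k-1}),\qquad v\in(W_k^D\oplus\operatorname{span}\{e_s\})^\perp\cap V_l^0,$$ and the $Q$-system $$q_{k-1}\cdot v=0\ (1\le k\le m),\qquad (Au)\cdot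 v=0\ (2\le k\le m,\ u\in W^Q_{k-1}),\qquad v\in(W_k^Q\oplus\operatorname{span}\{e_1\})^\perp.$$ **Theorem.** (a) The number of stages is $s=\frac{p^2-2p+8}4$. (b) There are nodes $c$ and weights $b$ as above such that, in addition, $b_i\ne0$ for all $l+N\le i\le s-1$ (the stages of the $D$-groups). For any such $c$ and $b$ the construction produces exactly one matrix $A$. (c) For all nodes $c$ and weights $b$ as above (whether or not the additional condition in (b) holds), every matrix $A$ produced by the construction has the following properties. The tableau $(A,b,c)$ is explicit; $\dim Q_m=l$; $Q_m\subseteq V_l^*$; $D_n\subseteq V_l^0$; every $d\in D_n$ satisfies the cluster condition; and, with $n\le m+1$ and $p\le m+n+1$, all of the following hold: * $B(p)$: $b\cdot c^{k-1}=\frac1k$ for $1\le k\le p$; * $QO(m)$: $b\odot Q_m=\{0\}$; * $DO(n)$: $D_n\cdot c^{k-1}=\{0\}$ for $1\le k\le p-n$; * $QD(m,n)$: $Q_m\odot D_n=\{0\}$; * $QR(m)$: $Q_{m_1}\odot Q_{m_2}\subseteq Q_{m_1}$ whenever $m_2\le m_1\le m$, with equality if $m_2=m_1$. Moreover $(A,b,c)$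 has order $p$. -/

import Mathlib

open Matrix Polynomial

noncomputable section

namespace ERK

/-! ### Rooted trees, elementary weights and order of a Runge-Kutta method

Vectors of `ℝ^s` are functions `Fin s → ℝ`; their product `*` and powers `^` are taken
componentwise (Hadamard product).  `stg i` is the stage number `1, …, s` of an index. -/

/-- The one-based stage number of an index. -/
def stg {s : ℕ} (i : Fin s) : ℕ := (i : ℕ) + 1

/-- Rooted trees `[t_1 ⋯ t_k]`, given by the (listed) subtrees at the root; the order of the list
plays no role for the functions below.  The one-vertex tree is the case `k = 0`. -/
inductive RootedTree : Type
  | node (k : ℕ) (children : Fin k → RootedTree) : RootedTree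

/-- The number of vertices `|t|`. -/
def RootedTree.order : RootedTree → ℕ
  | .node _ ts => 1 + ∑ i, (ts i).order

/-- The density `γ(t) = t!`. -/
def RootedTree.density : RootedTree → ℕ
  | .node k ts => (RootedTree.node k ts).order * ∏ i, (ts i).density

/-- The vectors `Φ([t_1 ⋯ t_k]) = ⨀ A Φ(t_i)`, with `Φ(•) = 1`. -/
def treeVec {s : ℕ} (A : Matrix (Fin s) (Fin s) ℝ) : RootedTree → (Fin s → ℝ)
  | .node _ ts => ∏ i, A *ᵥ treeVec A (ts i)

/-- The elementary weight `φ(t) = b · Φ(t)`. -/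
def elementaryWeight {s : ℕ} (A : Matrix (Fin s) (Fin s) ℝ) (b : Fin s → ℝ) (t : RootedTree) : ℝ :=
  b ⬝ᵥ treeVec A t

/-- The method has order (at least) `p`: `φ(t) = 1 / γ(t)` for every rooted tree with `|t| ≤ p`. -/
def HasOrder {s : ℕ} (p : ℕ) (A : Matrix (Fin s) (Fin s) ℝ) (b : Fin s → ℝ) : Prop :=
  ∀ t : RootedTree, t.order ≤ p → elementaryWeight A b t = 1 / (t.density : ℝ)

/-- `(A, b, c)` is the tableau of an explicit Runge-Kutta method: `A` is strictly lower triangular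
and its row sums are the `c_i`. -/
structure IsExplicitTableau {s : ℕ} (A : Matrix (Fin s) (Fin s) ℝ) (c : Fin s → ℝ) : Prop where
  strictly_lower : ∀ i j, i ≤ j → A i j = 0
  row_sum : ∀ i, c i = ∑ j, A i j

/-! ### The `Q`- and `D`-spaces and the sufficient conditions -/

/-- `q_k = A c^k - c^(k+1) / (k+1)`. -/
def qVec {s : ℕ} (A : Matrix (Fin s) (Fin s) ℝ) (c : Fin s → ℝ) (k : ℕ) : Fin s → ℝ :=
  A *ᵥ (c ^ k) - (1 / ((k : ℝ) + 1)) • c ^ (k + 1)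

/-- `d_k = (b ⊙ c^k)ᵀ A - b ⊙ (1 - c^(k+1)) / (k+1)`. -/
def dVec {s : ℕ} (A : Matrix (Fin s) (Fin s) ℝ) (b c : Fin s → ℝ) (k : ℕ) : Fin s → ℝ :=
  (b * c ^ k) ᵥ* A - (1 / ((k : ℝ) + 1)) • (b * (1 - c ^ (k + 1)))

/-- `Φ_1 = span {1, c}`. -/
def PhiOne {s : ℕ} (c : Fin s → ℝ) : Submodule ℝ (Fin s → ℝ) :=
  Submodule.span ℝ {1, c}

/-- `Q_0 = 0`, `Q_(k+1) = span {q_k, A Q_k, Q_k ⊙ Φ_1}`. -/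
def QSpace {s : ℕ} (A : Matrix (Fin s) (Fin s) ℝ) (c : Fin s → ℝ) :
    ℕ → Submodule ℝ (Fin s → ℝ)
  | 0 => ⊥
  | k + 1 => Submodule.span ℝ
      ({qVec A c k} ∪ (fun q => A *ᵥ q) '' (QSpace A c k : Set (Fin s → ℝ)) ∪
        Set.image2 (fun q f => q * f) (QSpace A c k : Set (Fin s → ℝ))
          (PhiOne c : Set (Fin s → ℝ)))

/-- `D_0 = 0`, `D_(k+1) = span {d_k, D_k ×¹ A, D_k ⊙ Φ_1}`. -/
def DSpace {s : ℕ} (A : Matrix (Fin s) (Fin s) ℝ) (b c : Fin s → ℝ) :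
    ℕ → Submodule ℝ (Fin s → ℝ)
  | 0 => ⊥
  | k + 1 => Submodule.span ℝ
      ({dVec A b c k} ∪ (fun d => d ᵥ* A) '' (DSpace A b c k : Set (Fin s → ℝ)) ∪
        Set.image2 (fun d f => d * f) (DSpace A b c k : Set (Fin s → ℝ))
          (PhiOne c : Set (Fin s → ℝ)))

/-- The conditions of the sufficiency theorem for order `p` with parameters `m`, `n`. -/
structure SufficientConditions {s : ℕ} (p m n : ℕ) (A : Matrix (Fin s) (Fin s) ℝ)
    (b c : Fin s → ℝ) : Prop where
  n_le : n ≤ m + 1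
  p_le : p ≤ m + n + 1
  /-- `B(p)` -/
  B : ∀ k : ℕ, 1 ≤ k → k ≤ p → b ⬝ᵥ c ^ (k - 1) = 1 / (k : ℝ)
  /-- `QO(m)` -/
  QO : ∀ q ∈ QSpace A c m, b * q = 0
  /-- `DO(n)` -/
  DO : ∀ d ∈ DSpace A b c n, ∀ k : ℕ, 1 ≤ k → k ≤ p - n → d ⬝ᵥ c ^ (k - 1) = 0
  /-- `QD(m, n)` -/
  QD : ∀ q ∈ QSpace A c m, ∀ d ∈ DSpace A b c n, q * d = 0
  /-- `QR(m)`: closure under the Hadamard product, -/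
  QR : ∀ m₁ m₂ : ℕ, m₂ ≤ m₁ → m₁ ≤ m →
    Set.image2 (fun q q' => q * q') (QSpace A c m₁ : Set (Fin s → ℝ))
      (QSpace A c m₂ : Set (Fin s → ℝ)) ⊆ (QSpace A c m₁ : Set (Fin s → ℝ))
  /-- with equality for equal indices. -/
  QR_eq : ∀ k : ℕ, k ≤ m →
    Set.image2 (fun q q' => q * q') (QSpace A c k : Set (Fin s → ℝ))
      (QSpace A c k : Set (Fin s → ℝ)) = (QSpace A c k : Set (Fin s → ℝ))

/-! ### Coordinate subspaces and node clusters -/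

/-- `V_l`: zero at the stages `2, …, l+1`. -/
def V (s l : ℕ) : Set (Fin s → ℝ) := {v | ∀ i, 2 ≤ stg i → stg i ≤ l + 1 → v i = 0}

/-- `V_l^*`: supported on the stages `2, …, l+1`. -/
def VStar (s l : ℕ) : Set (Fin s → ℝ) := {v | ∀ i, (stg i = 1 ∨ l + 2 ≤ stg i) → v i = 0}

/-- `V_l^0`: supported on the stages `l+2, …, s`. -/
def VZero (s l : ℕ) : Set (Fin s → ℝ) := {v | ∀ i, stg i ≤ l + 1 → v i = 0}

/-- The node cluster `S(ξ) = {i ∈ {l+2, …, s} : c_i = ξ}`. -/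
def cluster {s : ℕ} (l : ℕ) (c : Fin s → ℝ) (ξ : ℝ) : Finset (Fin s) :=
  Finset.univ.filter fun i => l + 2 ≤ stg i ∧ c i = ξ

/-- The entries of `d` sum to zero over every node cluster. -/
def ClusterCondition {s : ℕ} (l : ℕ) (c d : Fin s → ℝ) : Prop :=
  ∀ ξ : ℝ, ∑ i ∈ cluster l c ξ, d i = 0

/-! ### The Gauss-Lobatto rule on `[0, 1]` -/

/-- The `(N-2)`-nd derivative of `x^(N-1) (x-1)^(N-1)`, a multiple of `x (x-1) P'(2x-1)` with `P`
the Legendre polynomial of degree `N-1`; its roots are the Lobatto points of `[0, 1]`. -/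
def lobattoPoly (N : ℕ) : ℝ[X] :=
  derivative^[N - 2] (X ^ (N - 1) * (X - 1) ^ (N - 1))

/-- The Lobatto points `x_1 < x_2 < ⋯ < x_N`. -/
def lobattoNode (N i : ℕ) : ℝ :=
  ((lobattoPoly N).roots.sort (· ≤ ·)).getD (i - 1) 0

/-- The Lobatto weights `w_i`: the integrals over `[0, 1]` of the Lagrange basis polynomials. -/
def lobattoWeight (N i : ℕ) : ℝ :=
  ∫ t in (0 : ℝ)..1, (Lagrange.basis (Finset.Icc 1 N) (lobattoNode N) i).eval t

/-! ### The construction for even `p` -/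

/-- `m = p/2 - 1`. -/
def mOf (p : ℕ) : ℕ := p / 2 - 1

/-- `n = p/2`. -/
def nOf (p : ℕ) : ℕ := p / 2

/-- The number `N = n + 1` of Lobatto points. -/
def NOf (p : ℕ) : ℕ := nOf p + 1

/-- The number `l = m (m-1) / 2` of `Q`-type stages. -/
def lOf (p : ℕ) : ℕ := mOf p * (mOf p - 1) / 2

/-- The number of stages: `1`, plus `l` stages of `Q`-type, plus `n (n+1) / 2` of `D`-type. -/
def stages (p : ℕ) : ℕ := 1 + lOf p + nOf p * (nOf p + 1) / 2

/-- The stage number of the `r`-th ghost node (`1 ≤ r ≤ N-2`). -/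
def ghostPos (p r : ℕ) : ℕ := lOf p + 1 + r

/-- The stage number of the `r`-th node of the `j`-th `D`-group (`1 ≤ r ≤ j ≤ N-2`). -/
def dPos (p j r : ℕ) : ℕ := stages p - 1 - j * (j + 1) / 2 + r

/-- The stages of the `g`-th `Q`-group (`1 ≤ g ≤ m-1`), which has `g` elements. -/
def InQGroup (g i : ℕ) : Prop := g * (g - 1) / 2 + 2 ≤ i ∧ i ≤ g * (g + 1) / 2 + 1

/-- The arrangement of the stage vector: Lobatto points at the end stages, the ghost nodes and the
`D`-groups; the `Q`-group nodes are free, but nonzero and distinct within each `Q`-group. -/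
structure IsStageVector (p : ℕ) (c : Fin (stages p) → ℝ) : Prop where
  first : ∀ i, stg i = 1 → c i = lobattoNode (NOf p) 1
  last : ∀ i, stg i = stages p → c i = lobattoNode (NOf p) (NOf p)
  ghost : ∀ i r, 1 ≤ r → r ≤ NOf p - 2 → stg i = ghostPos p r →
    c i = lobattoNode (NOf p) (NOf p - r)
  dGroup : ∀ i j r, 1 ≤ r → r ≤ j → j ≤ NOf p - 2 → stg i = dPos p j r →
    c i = lobattoNode (NOf p) (NOf p - r)
  qGroup_ne_zero : ∀ g i, 1 ≤ g → g ≤ mOf p - 1 → InQGroup g (stg i) → c i ≠ 0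
  qGroup_distinct : ∀ g i j, 1 ≤ g → g ≤ mOf p - 1 → InQGroup g (stg i) → InQGroup g (stg j) →
    i ≠ j → c i ≠ c j

/-- The weight vector: zero at the `Q`-group stages, `w_1` and `w_N` at the ends, and summing to
the Lobatto weight over the cluster of every interior Lobatto point. -/
structure IsWeightVector (p : ℕ) (c b : Fin (stages p) → ℝ) : Prop where
  mem_V : b ∈ V (stages p) (lOf p)
  first : ∀ i, stg i = 1 → b i = lobattoWeight (NOf p) 1
  last : ∀ i, stg i = stages p → b i = lobattoWeight (NOf p) (NOf p)
  cluster_sum : ∀ j, 2 ≤ j → j ≤ NOf p - 1 →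
    ∑ i ∈ cluster (lOf p) c (lobattoNode (NOf p) j), b i = lobattoWeight (NOf p) j

/-- The weights at the `D`-group stages `l+N, …, s-1` are nonzero. -/
def DGroupWeightsNonzero (p : ℕ) (b : Fin (stages p) → ℝ) : Prop :=
  ∀ i, lOf p + NOf p ≤ stg i → stg i ≤ stages p - 1 → b i ≠ 0

/-- The positions `I^D` of the variables of the `D`-system. -/
def ID (p : ℕ) : Set (ℕ × ℕ) :=
  {x | x.1 = stages p ∧ lOf p + 2 ≤ x.2 ∧ x.2 ≤ stages p - 1} ∪
  {x | ∃ k, 2 ≤ k ∧ k ≤ nOf p ∧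
    stages p - 1 - k * (k - 1) / 2 < x.1 ∧ x.1 ≤ stages p - 1 - (k - 1) * (k - 2) / 2 ∧
    lOf p + 2 ≤ x.2 ∧ x.2 ≤ stages p - 1 - k * (k - 1) / 2}

/-- The positions `I^Q` of the variables of the `Q`-system. -/
def IQ (p : ℕ) : Set (ℕ × ℕ) :=
  {x | 2 ≤ x.1 ∧ x.1 ≤ stages p ∧ x.2 = 1} ∪
  {x | ∃ k, 2 ≤ k ∧ k ≤ mOf p ∧ k * (k - 1) / 2 + 2 ≤ x.1 ∧ x.1 ≤ stages p ∧
    (k - 1) * (k - 2) / 2 + 2 ≤ x.2 ∧ x.2 ≤ k * (k - 1) / 2 + 1}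

/-- The standard basis vector `e_a` of `ℝ^s` (one-based). -/
def stdVec (s a : ℕ) : Fin s → ℝ := fun i => if stg i = a then 1 else 0

/-- The vector `ε_{j,r}`: `1` at the `r`-th stage of the `j`-th `D`-group, `-1` at the `r`-th ghost
stage, `0` elsewhere. -/
def epsVec (p j r : ℕ) : Fin (stages p) → ℝ :=
  stdVec (stages p) (dPos p j r) - stdVec (stages p) (ghostPos p r)

/-- `W_k^D = span {ε_{j,r} : 1 ≤ r ≤ j ≤ k-1}`. -/
def WD (p k : ℕ) : Submodule ℝ (Fin (stages p) → ℝ) :=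
  Submodule.span ℝ {v | ∃ j r, 1 ≤ r ∧ r ≤ j ∧ j ≤ k - 1 ∧ v = epsVec p j r}

/-- The test space `(W_k^D ⊕ span {e_s})^⊥ ∩ V_l^0` of the `D`-system. -/
def DTest (p k : ℕ) : Set (Fin (stages p) → ℝ) :=
  {v | (∀ w ∈ WD p k ⊔ Submodule.span ℝ {stdVec (stages p) (stages p)}, w ⬝ᵥ v = 0) ∧
    v ∈ VZero (stages p) (lOf p)}

/-- The `D`-system. -/
structure DSystem (p : ℕ) (A : Matrix (Fin (stages p)) (Fin (stages p)) ℝ)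
    (b c : Fin (stages p) → ℝ) : Prop where
  d_eq : ∀ k, 1 ≤ k → k ≤ nOf p → ∀ v ∈ DTest p k, dVec A b c (k - 1) ⬝ᵥ v = 0
  dA_eq : ∀ k, 2 ≤ k → k ≤ nOf p → ∀ u ∈ WD p (k - 1), ∀ v ∈ DTest p k, (u ᵥ* A) ⬝ᵥ v = 0

/-- `W_k^Q = span {e_2, …, e_{k(k-1)/2+1}}`. -/
def WQ (p k : ℕ) : Submodule ℝ (Fin (stages p) → ℝ) :=
  Submodule.span ℝ {v | ∃ a, 2 ≤ a ∧ a ≤ k * (k - 1) / 2 + 1 ∧ v = stdVec (stages p) a}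

/-- The test space `(W_k^Q ⊕ span {e_1})^⊥` of the `Q`-system. -/
def QTest (p k : ℕ) : Set (Fin (stages p) → ℝ) :=
  {v | ∀ w ∈ WQ p k ⊔ Submodule.span ℝ {stdVec (stages p) 1}, w ⬝ᵥ v = 0}

/-- The `Q`-system. -/
structure QSystem (p : ℕ) (A : Matrix (Fin (stages p)) (Fin (stages p)) ℝ)
    (c : Fin (stages p) → ℝ) : Prop where
  q_eq : ∀ k, 1 ≤ k → k ≤ mOf p → ∀ v ∈ QTest p k, qVec A c (k - 1) ⬝ᵥ v = 0
  Aq_eq : ∀ k, 2 ≤ k → k ≤ mOf p → ∀ u ∈ WQ p (k - 1), ∀ v ∈ QTest p k, (A *ᵥ u) ⬝ᵥ v = 0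

/-- `A` is an output of the construction for the nodes `c` and weights `b`: it vanishes outside the
positions of the variables and solves the `D`-system and the `Q`-system. -/
structure IsConstructed (p : ℕ) (A : Matrix (Fin (stages p)) (Fin (stages p)) ℝ)
    (b c : Fin (stages p) → ℝ) : Prop where
  support : ∀ i j, (stg i, stg j) ∉ ID p ∪ IQ p → A i j = 0
  dSystem : DSystem p A b c
  qSystem : QSystem p A c

end ERK

end

namespace ERK

/-! ### The sufficient conditions imply the order -/

section Order

variable {s : ℕ} {A : Matrix (Fin s) (Fin s) ℝ} {b c : Fin s → ℝ}

/-! The sufficient conditions give the order by induction on trees. By `QR`, a branch of order at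
most m equals c^|t|/γ(t) modulo Q_|t|, so a vector annihilating Q_m sees only the orders and
densities of such branches. Since p ≤ m+n+1 and n ≤ m+1, a tree with at most p vertices has at most
one larger branch at the root. Splitting it off turns b⊙c^j into (b⊙c^k)×¹A, which is d_k plus a
combination of b and b⊙c^(k+1); the d_k term drops out by the analogous induction on D_k
(`dotProduct_DSpace`, `dotProduct_pow_treeVec`).

The construction becomes transparent once stages carry two numbers: the level (0 for the first
stage, g in the g-th Q-group, at least m from stage l+2 on) and the colevel (0 for the last stage, j
in the j-th D-group, n for ghosts). The positions in I^Q say that the column level is below m and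
below the row level; those in I^D say the same with colevels, on outer columns. Evaluating the test
spaces turns the two systems into the coordinate conditions of `Solves` (`isConstructed_iff`).

Each coordinate system is a square Vandermonde system with distinct nodes. A column in the D-group
of colevel g has unknowns in the last row and in the rows of colevel g-1, hence g unknowns and g
equations. A ghost column follows from the sums of the entries over its cluster. With the outer
columns known, a row of level g has min(g,m) unknown entries and as many equations. Division by the
weights in the D-part needs nonzero D-group weights and w_N ≠ 0. This gives existence and
uniqueness.

For the asserted properties, Q_k is exactly the space of vectors supported on levels 1,…,k-1
(`Solves.QSpace_eq`); a Vandermonde argument gives the lower bound, and `QO`, `QR` and the dimension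
follow at once. Dually D_k ⊆ W_k^D (`Solves.DSpace_le_WD`): the difference of a D-group row and its
ghost row is orthogonal to c^q for q < m and has vanishing cluster sums, so a Vandermonde argument
kills its entries in the inner columns. Elements of W_n^D are orthogonal to vectors constant on
clusters, which yields `DO`, `QD` and the cluster condition. Condition `B` is the exactness of the
Lobatto rule up to degree 2N-3, with the weight of each interior point spread over its cluster. -/

theorem one_mem_PhiOne : (1 : Fin s → ℝ) ∈ PhiOne c := Submodule.subset_span (by simp)

theorem self_mem_PhiOne : c ∈ PhiOne c := Submodule.subset_span (by simp)

theorem qVec_mem_QSpace (k : ℕ) : qVec A c k ∈ QSpace A c (k + 1) :=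
  Submodule.subset_span (Or.inl (Or.inl rfl))

theorem mulVec_mem_QSpace {k : ℕ} {q : Fin s → ℝ} (hq : q ∈ QSpace A c k) :
    A *ᵥ q ∈ QSpace A c (k + 1) :=
  Submodule.subset_span (Or.inl (Or.inr ⟨q, hq, rfl⟩))

theorem mul_self_mem_QSpace {k : ℕ} {q : Fin s → ℝ} (hq : q ∈ QSpace A c k) :
    q * c ∈ QSpace A c (k + 1) :=
  Submodule.subset_span (Or.inr ⟨q, hq, c, self_mem_PhiOne, rfl⟩)

theorem QSpace_le_succ (k : ℕ) : QSpace A c k ≤ QSpace A c (k + 1) := fun q hq =>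
  Submodule.subset_span (Or.inr ⟨q, hq, 1, one_mem_PhiOne, mul_one q⟩)

theorem QSpace_mono : Monotone (QSpace A c) := monotone_nat_of_le_succ QSpace_le_succ

theorem mul_pow_mem_QSpace {k : ℕ} {q : Fin s → ℝ} (hq : q ∈ QSpace A c k) (e : ℕ) :
    q * c ^ e ∈ QSpace A c (k + e) := by
  induction e with
  | zero => simpa using hq
  | succ e ih =>
    rw [pow_succ, ← mul_assoc]
    exact mul_self_mem_QSpace ih

theorem dVec_mem_DSpace (k : ℕ) : dVec A b c k ∈ DSpace A b c (k + 1) :=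
  Submodule.subset_span (Or.inl (Or.inl rfl))

theorem vecMul_mem_DSpace {k : ℕ} {d : Fin s → ℝ} (hd : d ∈ DSpace A b c k) :
    d ᵥ* A ∈ DSpace A b c (k + 1) :=
  Submodule.subset_span (Or.inl (Or.inr ⟨d, hd, rfl⟩))

theorem mul_self_mem_DSpace {k : ℕ} {d : Fin s → ℝ} (hd : d ∈ DSpace A b c k) :
    d * c ∈ DSpace A b c (k + 1) :=
  Submodule.subset_span (Or.inr ⟨d, hd, c, self_mem_PhiOne, rfl⟩)

theorem DSpace_le_succ (k : ℕ) : DSpace A b c k ≤ DSpace A b c (k + 1) := fun q hq =>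
  Submodule.subset_span (Or.inr ⟨q, hq, 1, one_mem_PhiOne, mul_one q⟩)

theorem DSpace_mono : Monotone (DSpace A b c) := monotone_nat_of_le_succ DSpace_le_succ

theorem mul_pow_mem_DSpace {k : ℕ} {d : Fin s → ℝ} (hd : d ∈ DSpace A b c k) (e : ℕ) :
    d * c ^ e ∈ DSpace A b c (k + e) := by
  induction e with
  | zero => simpa using hd
  | succ e ih =>
    rw [pow_succ, ← mul_assoc]
    exact mul_self_mem_DSpace ih

theorem RootedTree.one_le_order (t : RootedTree) : 1 ≤ t.order := by
  cases t; simp [RootedTree.order]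

/-- A family of branches that equal powers of the nodes up to elements of the `Q`-spaces has a
product of the same form. -/
theorem prod_sub_mem_QSpace {m : ℕ}
    (hQR : ∀ m₁ m₂ : ℕ, m₂ ≤ m₁ → m₁ ≤ m →
      Set.image2 (fun q q' => q * q') (QSpace A c m₁ : Set (Fin s → ℝ))
        (QSpace A c m₂ : Set (Fin s → ℝ)) ⊆ (QSpace A c m₁ : Set (Fin s → ℝ)))
    {ι : Type*} (S : Finset ι) (x : ι → Fin s → ℝ) (e : ι → ℕ) (γ : ι → ℝ)
    (hx : ∀ i ∈ S, e i ≤ m → x i - γ i • c ^ e i ∈ QSpace A c (e i))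
    (hS : ∑ i ∈ S, e i ≤ m) :
    ∏ i ∈ S, x i - (∏ i ∈ S, γ i) • c ^ (∑ i ∈ S, e i) ∈ QSpace A c (∑ i ∈ S, e i) := by
  classical
  induction S using Finset.induction_on with
  | empty => simp
  | insert a S ha ih =>
    rw [Finset.sum_insert ha] at hS
    rw [Finset.sum_insert ha, Finset.prod_insert ha, Finset.prod_insert ha]
    have h1 := hx a (Finset.mem_insert_self a S) (by omega)
    have h2 := ih (fun i hi => hx i (Finset.mem_insert_of_mem hi)) (by omega)
    set X := ∏ i ∈ S, x i
    set G := ∏ i ∈ S, γ i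
    set E := ∑ i ∈ S, e i
    -- `QR` places the product in the space of the larger index, so the factors are ordered
    -- accordingly.
    have h3 : (x a - γ a • c ^ e a) * (X - G • c ^ E) ∈ QSpace A c (e a + E) := by
      rcases le_total (e a) E with h | h
      · refine QSpace_mono (Nat.le_add_left E (e a)) ?_
        rw [mul_comm]
        exact hQR E (e a) h (by omega) ⟨_, h2, _, h1, rfl⟩
      · refine QSpace_mono (Nat.le_add_right (e a) E) ?_
        exact hQR (e a) E h (by omega) ⟨_, h1, _, h2, rfl⟩
    have h4 := (QSpace A c (e a + E)).smul_mem G (mul_pow_mem_QSpace h1 E)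
    have h5 : γ a • ((X - G • c ^ E) * c ^ e a) ∈ QSpace A c (e a + E) := by
      have := mul_pow_mem_QSpace h2 (e a)
      rw [add_comm E] at this
      exact (QSpace A c (e a + E)).smul_mem _ this
    have h6 : x a * X - (γ a * G) • c ^ (e a + E) =
        (x a - γ a • c ^ e a) * (X - G • c ^ E) + G • ((x a - γ a • c ^ e a) * c ^ E)
          + γ a • ((X - G • c ^ E) * c ^ e a) := by
      ext i
      simp only [Pi.sub_apply, Pi.add_apply, Pi.mul_apply, Pi.smul_apply, Pi.pow_apply,
        smul_eq_mul, pow_add]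
      ring
    rw [h6]
    exact add_mem (add_mem h3 h4) h5

theorem density_node (k : ℕ) (ts : Fin k → RootedTree) :
    ((RootedTree.node k ts).density : ℝ) =
      (1 + ∑ i, ((ts i).order : ℝ)) * ∏ i, ((ts i).density : ℝ) := by
  simp [RootedTree.density, RootedTree.order]

/-- Branches of order at most `m` are `c^|t| / γ(t)` up to an element of `Q_|t|`. -/
theorem mulVec_treeVec_sub_mem_QSpace {m : ℕ}
    (hQR : ∀ m₁ m₂ : ℕ, m₂ ≤ m₁ → m₁ ≤ m →
      Set.image2 (fun q q' => q * q') (QSpace A c m₁ : Set (Fin s → ℝ))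
        (QSpace A c m₂ : Set (Fin s → ℝ)) ⊆ (QSpace A c m₁ : Set (Fin s → ℝ)))
    (t : RootedTree) (ht : t.order ≤ m) :
    A *ᵥ treeVec A t - (1 / (t.density : ℝ)) • c ^ t.order ∈ QSpace A c t.order := by
  induction t with
  | node k ts ih =>
    have ho : (RootedTree.node k ts).order = (∑ i, (ts i).order) + 1 := by
      simp [RootedTree.order, add_comm]
    rw [ho] at ht ⊢
    have h1 := prod_sub_mem_QSpace hQR Finset.univ (fun i => A *ᵥ treeVec A (ts i))
      (fun i => (ts i).order) (fun i => 1 / ((ts i).density : ℝ)) (fun i _ h => ih i h) (by omega)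
    set E := ∑ i, (ts i).order with hE
    set G := ∏ i, (1 / ((ts i).density : ℝ)) with hG
    have h2 := mulVec_mem_QSpace h1
    have h3 := (QSpace A c (E + 1)).smul_mem G (qVec_mem_QSpace (A := A) (c := c) E)
    have h4 := add_mem h2 h3
    convert h4 using 1
    have hd : 1 / ((RootedTree.node k ts).density : ℝ) = G * (1 / ((E : ℝ) + 1)) := by
      rw [density_node, hG, Finset.prod_div_distrib, hE]
      push_cast
      simp only [Finset.prod_const_one]
      rw [div_mul_div_comm, one_mul, add_comm, mul_comm]
    rw [hd, mulVec_sub, mulVec_smul, qVec, smul_sub, smul_smul]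
    simp only [treeVec]
    abel

/-- Elements annihilating each difference `x i - y i` annihilate the difference of products. -/
theorem mul_prod_eq_mul_prod {R ι : Type*} [CommRing R] (u : R) (S : Finset ι) (x y : ι → R)
    (h : ∀ i ∈ S, u * (x i - y i) = 0) : u * ∏ i ∈ S, x i = u * ∏ i ∈ S, y i := by
  classical
  induction S using Finset.induction_on with
  | empty => simp
  | insert a S ha ih =>
    have h1 := h a (Finset.mem_insert_self a S)
    have h2 := ih (fun i hi => h i (Finset.mem_insert_of_mem hi))
    rw [Finset.prod_insert ha, Finset.prod_insert ha]
    linear_combination (∏ i ∈ S, x i) * h1 + y a * h2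

theorem prod_smul_pow {ι : Type*} (S : Finset ι) (γ : ι → ℝ) (e : ι → ℕ) :
    ∏ i ∈ S, (γ i • c ^ e i) = (∏ i ∈ S, γ i) • c ^ (∑ i ∈ S, e i) := by
  ext i
  simp [Finset.prod_mul_distrib, Finset.prod_pow_eq_pow_sum]

variable {p m n : ℕ}

/-- A vector annihilating `Q_m` sees only the orders and densities of the small branches. -/
theorem SufficientConditions.mul_prod_branches (h : SufficientConditions p m n A b c)
    {u : Fin s → ℝ} (hu : ∀ q ∈ QSpace A c m, u * q = 0) {k : ℕ} (ts : Fin k → RootedTree)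
    (S : Finset (Fin k)) (hS : ∀ i ∈ S, (ts i).order ≤ m) :
    u * ∏ i ∈ S, A *ᵥ treeVec A (ts i) =
      (∏ i ∈ S, (1 / ((ts i).density : ℝ))) • (u * c ^ (∑ i ∈ S, (ts i).order)) := by
  rw [mul_prod_eq_mul_prod u S _ (fun i => (1 / ((ts i).density : ℝ)) • c ^ (ts i).order),
    prod_smul_pow, mul_smul_comm]
  intro i hi
  exact hu _ (QSpace_mono (hS i hi) (mulVec_treeVec_sub_mem_QSpace h.QR _ (hS i hi)))

theorem mul_dotProduct (u v w : Fin s → ℝ) : (u * v) ⬝ᵥ w = u ⬝ᵥ (v * w) := by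
  simp [dotProduct, mul_assoc]

/-- The branch `i` at the root is split off. -/
theorem SufficientConditions.dotProduct_treeVec (h : SufficientConditions p m n A b c)
    {u : Fin s → ℝ} (hu : ∀ q ∈ QSpace A c m, u * q = 0) {k : ℕ} (ts : Fin k → RootedTree)
    (i₀ : Fin k) (hS : ∀ i, i ≠ i₀ → (ts i).order ≤ m) :
    u ⬝ᵥ treeVec A (.node k ts) =
      (∏ i ∈ Finset.univ.erase i₀, (1 / ((ts i).density : ℝ))) *
        (((u * c ^ (∑ i ∈ Finset.univ.erase i₀, (ts i).order)) ᵥ* A) ⬝ᵥ treeVec A (ts i₀)) := by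
  rw [treeVec, ← Finset.prod_erase_mul _ _ (Finset.mem_univ i₀), ← mul_dotProduct,
    h.mul_prod_branches hu ts _ (fun i hi => hS i (Finset.ne_of_mem_erase hi)),
    ← dotProduct_mulVec, smul_dotProduct, smul_eq_mul]

/-- If all branches are small, the tree acts as a power of c and `DO` applies. Otherwise the unique
large branch absorbs d⊙c^E followed by A, an element of D_(k+E+1), and its order exceeds m, so that
k+E+1 ≤ n keeps the induction within range. -/
theorem SufficientConditions.dotProduct_DSpace (h : SufficientConditions p m n A b c) (hnp : n < p)
    (t : RootedTree) : ∀ k, k ≤ n → t.order + k ≤ p → ∀ d ∈ DSpace A b c k,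
      d ⬝ᵥ treeVec A t = 0 := by
  have hp := h.p_le
  induction t with
  | node r ts ih =>
    intro k hk ht d hd
    have hu : ∀ q ∈ QSpace A c m, d * q = 0 := fun q hq => by
      rw [mul_comm]; exact h.QD q hq d (DSpace_mono hk hd)
    simp only [RootedTree.order] at ht
    by_cases hS : ∀ i, (ts i).order ≤ m
    · have h1 := h.mul_prod_branches hu ts Finset.univ (fun i _ => hS i)
      set E := ∑ i, (ts i).order
      -- `DO` covers only exponents below p-n. As many factors c as D_n allows, at most n-k, are
      -- therefore moved into d; the rest is small because E+1+k ≤ p.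
      have h2 : d ⬝ᵥ c ^ E = 0 := by
        have hmem : d * c ^ (min E (n - k)) ∈ DSpace A b c n :=
          DSpace_mono (by omega) (mul_pow_mem_DSpace hd (min E (n - k)))
        have h3 := h.DO _ hmem (E - min E (n - k) + 1) (by omega) (by omega)
        rwa [mul_dotProduct, ← pow_add, Nat.add_sub_cancel,
          Nat.add_sub_cancel' (min_le_left _ _)] at h3
      have h4 : d ⬝ᵥ treeVec A (.node r ts) = (d * treeVec A (.node r ts)) ⬝ᵥ 1 := by
        rw [mul_dotProduct, mul_one]
      rw [h4, treeVec, h1, smul_dotProduct, mul_dotProduct, mul_one, h2, smul_zero]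
    · push Not at hS
      obtain ⟨i₀, hi₀⟩ := hS
      have hsum := Finset.sum_erase_add Finset.univ (fun i => (ts i).order) (Finset.mem_univ i₀)
      rw [h.dotProduct_treeVec hu ts i₀]
      · set E := ∑ i ∈ Finset.univ.erase i₀, (ts i).order
        rw [ih i₀ (k + E + 1) (by omega) (by omega) _
          (vecMul_mem_DSpace (mul_pow_mem_DSpace hd E)), mul_zero]
      -- The other branches together have at most n-1 ≤ m vertices, so there is no second large one.
      · intro i hi
        have := Finset.single_le_sum (f := fun i => (ts i).order) (fun _ _ => Nat.zero_le _)
          (Finset.mem_erase.2 ⟨hi, Finset.mem_univ i⟩)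
        have hn := h.n_le
        omega

/-- The factor c^j is what makes the induction close: splitting off a large branch produces b and
b⊙c^(j+E+1), both of the same form. Only j = 0 is needed in the end. -/
theorem SufficientConditions.dotProduct_pow_treeVec (h : SufficientConditions p m n A b c)
    (hnp : n < p) (t : RootedTree) : ∀ j, t.order + j ≤ p →
      (b * c ^ j) ⬝ᵥ treeVec A t = t.order / ((t.order + j : ℝ) * t.density) := by
  have hp := h.p_le
  induction t with
  | node r ts ih =>
    intro j ht
    have hu : ∀ q ∈ QSpace A c m, (b * c ^ j) * q = 0 := fun q hq => by
      rw [mul_right_comm, h.QO q hq, zero_mul]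
    rw [density_node]
    simp only [RootedTree.order] at ht ⊢
    push_cast
    by_cases hS : ∀ i, (ts i).order ≤ m
    · have h1 := h.mul_prod_branches hu ts Finset.univ (fun i _ => hS i)
      have h4 : (b * c ^ j) ⬝ᵥ treeVec A (.node r ts)
          = ((b * c ^ j) * treeVec A (.node r ts)) ⬝ᵥ 1 := by
        rw [mul_dotProduct (b * c ^ j), mul_one]
      rw [h4, treeVec, h1, smul_dotProduct, mul_dotProduct, mul_one, mul_dotProduct, ← pow_add]
      have h5 := h.B (j + ∑ i, (ts i).order + 1) (by omega) (by omega)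
      rw [Nat.add_sub_cancel] at h5
      rw [h5, Finset.prod_div_distrib]
      push_cast
      simp only [Finset.prod_const_one, smul_eq_mul]
      have : (1 + ∑ i, ((ts i).order : ℝ)) ≠ 0 := by positivity
      have h7 : (j + ∑ i, ((ts i).order : ℝ) + 1) = (1 + ∑ i, ((ts i).order : ℝ)) + j := by ring
      rw [h7, div_mul_div_comm, one_mul, mul_left_comm, mul_comm _ (_ + (j : ℝ)),
        div_mul_cancel_left₀ this, one_div]
    · push Not at hS
      obtain ⟨i₀, hi₀⟩ := hS
      have hsum := Finset.sum_erase_add Finset.univ (fun i => (ts i).order) (Finset.mem_univ i₀)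
      rw [h.dotProduct_treeVec hu ts i₀]
      · have hsumR : ∑ i, ((ts i).order : ℝ) =
            ((∑ i ∈ Finset.univ.erase i₀, (ts i).order : ℕ) : ℝ) + (ts i₀).order := by
          exact_mod_cast hsum.symm
        rw [← Finset.prod_erase_mul Finset.univ (fun i => ((ts i).density : ℝ))
          (Finset.mem_univ i₀), Finset.prod_div_distrib, hsumR]
        set E := ∑ i ∈ Finset.univ.erase i₀, (ts i).order
        set G := ∏ i ∈ Finset.univ.erase i₀, ((ts i).density : ℝ)
        have h3 : (b * c ^ j * c ^ E) ᵥ* A = dVec A b c (j + E)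
            + (1 / (((j + E : ℕ) : ℝ) + 1)) • (b * c ^ 0 - b * c ^ (j + E + 1)) := by
          rw [dVec, mul_assoc, ← pow_add, pow_zero, mul_sub]
          abel
        rw [h3, add_dotProduct, smul_dotProduct, sub_dotProduct, ih i₀ 0 (by omega),
          ih i₀ (j + E + 1) (by omega),
          h.dotProduct_DSpace hnp _ (j + E + 1) (by omega) (by omega) _ (dVec_mem_DSpace _)]
        simp only [Finset.prod_const_one, smul_eq_mul]
        have ho : (1 : ℝ) ≤ (ts i₀).order := by exact_mod_cast (ts i₀).one_le_order
        push_cast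
        -- Densities are in fact positive; both sides vanish in the zero cases, so positivity need
        -- not be proved.
        rcases eq_or_ne G 0 with hG | hG
        · simp [hG]
        rcases eq_or_ne ((ts i₀).density : ℝ) 0 with hg | hg
        · simp [hg]
        have e1 : ((j : ℝ) + E + 1) ≠ 0 := by positivity
        have e2 : ((ts i₀).order + ((j : ℝ) + E + 1)) ≠ 0 := by positivity
        have e3 : (1 + ((E : ℝ) + (ts i₀).order)) ≠ 0 := by positivity
        have e4 : (1 + ((E : ℝ) + (ts i₀).order) + j) ≠ 0 := by positivity
        have e5 : ((ts i₀).order : ℝ) ≠ 0 := by positivity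
        field_simp
        ring
      · intro i hi
        have := Finset.single_le_sum (f := fun i => (ts i).order) (fun _ _ => Nat.zero_le _)
          (Finset.mem_erase.2 ⟨hi, Finset.mem_univ i⟩)
        have hn := h.n_le
        omega

/-- The sufficient conditions imply order `p`. -/
theorem SufficientConditions.hasOrder (h : SufficientConditions p m n A b c) (hnp : n < p) :
    HasOrder p A b := by
  intro t ht
  have h1 := h.dotProduct_pow_treeVec hnp t 0 (by omega)
  have ho : ((t.order : ℝ)) ≠ 0 := by
    have := t.one_le_order
    positivity
  rw [pow_zero, mul_one, Nat.cast_zero, add_zero, div_mul_cancel_left₀ ho] at h1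
  rw [elementaryWeight, h1, one_div]

end Order

/-! ### The Gauss-Lobatto rule -/

section Lobatto

/-- `x^M (x-1)^M`. -/
noncomputable def lobattoBase (M : ℕ) : ℝ[X] := X ^ M * (X - 1) ^ M

theorem lobattoPoly_eq (N : ℕ) : lobattoPoly N = derivative^[N - 2] (lobattoBase (N - 1)) := rfl

theorem eval_zero_iterate_derivative_lobattoBase {M j : ℕ} (h : j < M) :
    (derivative^[j] (lobattoBase M)).eval 0 = 0 := by
  have h1 : (X : ℝ[X]) ^ (M - j) ∣ derivative^[j] (lobattoBase M) :=
    pow_sub_dvd_iterate_derivative_of_pow_dvd j (Dvd.intro _ rfl)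
  obtain ⟨q, hq⟩ := h1
  rw [hq, eval_mul, eval_pow, eval_X, zero_pow (by omega), zero_mul]

theorem eval_one_iterate_derivative_lobattoBase {M j : ℕ} (h : j < M) :
    (derivative^[j] (lobattoBase M)).eval 1 = 0 := by
  have h1 : (X - 1 : ℝ[X]) ^ (M - j) ∣ derivative^[j] (lobattoBase M) :=
    pow_sub_dvd_iterate_derivative_of_pow_dvd j (Dvd.intro_left _ rfl)
  obtain ⟨q, hq⟩ := h1
  rw [hq, eval_mul, eval_pow, eval_sub, eval_X, eval_one, sub_self, zero_pow (by omega), zero_mul]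

theorem lobattoBase_ne_zero (M : ℕ) : lobattoBase M ≠ 0 :=
  mul_ne_zero (pow_ne_zero _ X_ne_zero) (pow_ne_zero _ (X_sub_C_ne_zero (1 : ℝ)))

theorem zero_one_subset_roots {M j : ℕ} (h : j < M)
    (h0 : derivative^[j] (lobattoBase M) ≠ 0) :
    ({0, 1} : Finset ℝ) ⊆ (derivative^[j] (lobattoBase M)).roots.toFinset := by
  intro x hx
  rw [Multiset.mem_toFinset, mem_roots h0]
  simp only [Finset.mem_insert, Finset.mem_singleton] at hx
  rcases hx with rfl | rfl
  · exact eval_zero_iterate_derivative_lobattoBase h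
  · exact eval_one_iterate_derivative_lobattoBase h

theorem card_zero_one : ({0, 1} : Finset ℝ).card = 2 := Finset.card_pair zero_ne_one

/-- Rolle's theorem produces one more root with every derivative. -/
theorem le_card_roots_iterate_derivative {M j : ℕ} (h : j < M) :
    j + 2 ≤ (derivative^[j] (lobattoBase M)).roots.toFinset.card := by
  induction j with
  | zero =>
    have := Finset.card_le_card (zero_one_subset_roots h (lobattoBase_ne_zero M))
    rwa [card_zero_one] at this
  | succ j ih =>
    have ih := ih (by omega)
    have h1 := card_roots_toFinset_le_card_roots_derivative_sdiff_roots_succ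
      (derivative^[j] (lobattoBase M))
    rw [← Function.iterate_succ_apply' derivative, Nat.succ_eq_add_one] at h1
    have h0 : derivative^[j + 1] (lobattoBase M) ≠ 0 := by
      intro h0
      rw [h0] at h1
      simp at h1
      omega
    have hj : derivative^[j] (lobattoBase M) ≠ 0 := by
      intro hj
      rw [hj] at ih
      simp at ih
    have h2 := zero_one_subset_roots h h0
    have h3 := zero_one_subset_roots (j := j) (by omega) hj
    have h4 : (derivative^[j + 1] (lobattoBase M)).roots.toFinset \
          (derivative^[j] (lobattoBase M)).roots.toFinset ⊆
        (derivative^[j + 1] (lobattoBase M)).roots.toFinset \ {0, 1} :=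
      Finset.sdiff_subset_sdiff le_rfl h3
    have h5 := Finset.card_le_card h4
    rw [Finset.card_sdiff_of_subset h2, card_zero_one] at h5
    omega

theorem natDegree_lobattoBase_le (M : ℕ) : (lobattoBase M).natDegree ≤ 2 * M := by
  refine natDegree_mul_le.trans ?_
  have h1 : ((X : ℝ[X]) ^ M).natDegree = M := natDegree_X_pow M
  have h2 : ((X - 1 : ℝ[X]) ^ M).natDegree ≤ M * 1 :=
    natDegree_pow_le_of_le M (natDegree_X_sub_C_le (1 : ℝ))
  omega

variable {N : ℕ}

/-- Rolle gives at least N distinct roots, while the degree is at most 2(N-1)-(N-2) = N. Equality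
holds throughout, so all roots are real and simple. -/
theorem lobattoPoly_card_roots (hN : 2 ≤ N) :
    (lobattoPoly N).roots.card = N ∧ (lobattoPoly N).roots.Nodup ∧
      (lobattoPoly N).natDegree = N ∧ lobattoPoly N ≠ 0 := by
  have h1 := le_card_roots_iterate_derivative (M := N - 1) (j := N - 2) (by omega)
  rw [← lobattoPoly_eq] at h1
  have h2 := Multiset.toFinset_card_le (lobattoPoly N).roots
  have h3 := card_roots' (lobattoPoly N)
  have h4 : (lobattoPoly N).natDegree ≤ N := by
    have := natDegree_iterate_derivative (lobattoBase (N - 1)) (N - 2)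
    have h5 := natDegree_lobattoBase_le (N - 1)
    rw [← lobattoPoly_eq] at this
    omega
  refine ⟨by omega, Multiset.toFinset_card_eq_card_iff_nodup.1 (by omega), by omega, ?_⟩
  intro h0
  rw [h0] at h1
  simp at h1

/-- All roots of the derivatives of `x^M (x-1)^M` lie in `[0, 1]`, by the Gauss-Lucas theorem. -/
theorem rootSet_iterate_derivative_subset {M j : ℕ} (h : j < M) :
    ((derivative^[j] (lobattoBase M)).map (algebraMap ℝ ℂ)).rootSet ℂ ⊆ segment ℝ (0 : ℂ) 1 := by
  induction j with
  | zero =>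
    intro z hz
    have h1 := (mem_rootSet.1 hz).2
    simp only [Function.iterate_zero, id_eq, lobattoBase, Polynomial.map_mul, Polynomial.map_pow,
      map_X, Polynomial.map_sub, Polynomial.map_one, coe_aeval_eq_eval, eval_mul, eval_pow, eval_X,
      eval_sub, eval_one] at h1
    rcases mul_eq_zero.1 h1 with h1 | h1
    · rw [pow_eq_zero_iff (by omega)] at h1
      rw [h1]; exact left_mem_segment ℝ _ _
    · rw [pow_eq_zero_iff (by omega), sub_eq_zero] at h1
      rw [h1]; exact right_mem_segment ℝ _ _
  | succ j ih =>
    have ih := ih (by omega)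
    rw [Function.iterate_succ_apply', ← derivative_map]
    refine (rootSet_derivative_subset_convexHull_rootSet ?_).trans
      (convexHull_min ih (convex_segment _ _))
    rw [degree_map, ← natDegree_pos_iff_degree_pos]
    have h1 := le_card_roots_iterate_derivative (M := M) (j := j) (by omega)
    have h2 := Multiset.toFinset_card_le (derivative^[j] (lobattoBase M)).roots
    have h3 := card_roots' (derivative^[j] (lobattoBase M))
    omega

theorem mem_Icc_of_isRoot_lobattoPoly (hN : 2 ≤ N) {x : ℝ} (hx : (lobattoPoly N).IsRoot x) :
    x ∈ Set.Icc (0 : ℝ) 1 := by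
  have h0 := (lobattoPoly_card_roots hN).2.2.2
  have h1 : (x : ℂ) ∈ ((lobattoPoly N).map (algebraMap ℝ ℂ)).rootSet ℂ := by
    rw [mem_rootSet]
    refine ⟨(Polynomial.map_ne_zero_iff (algebraMap ℝ ℂ).injective).2 h0, ?_⟩
    have h2 := eval_map_algebraMap (lobattoPoly N) (x : ℂ)
    have h3 := aeval_algebraMap_apply_eq_algebraMap_eval (A := ℂ) x (lobattoPoly N)
    rw [coe_aeval_eq_eval, h2]
    refine h3.trans ?_
    rw [hx.eq_zero, map_zero]
  have h2 := rootSet_iterate_derivative_subset (M := N - 1) (j := N - 2) (by omega) h1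
  obtain ⟨a, b, ha, hb, hab, h⟩ := h2
  have h3 : b = x := by
    have := congrArg Complex.re h
    simpa using this
  exact ⟨h3 ▸ hb, by linarith⟩

theorem length_sort_lobattoPoly (hN : 2 ≤ N) :
    ((lobattoPoly N).roots.sort (· ≤ ·)).length = N := by
  rw [Multiset.length_sort, (lobattoPoly_card_roots hN).1]

theorem lobattoNode_eq_getElem (hN : 2 ≤ N) {i : ℕ} (hi : 1 ≤ i) (hiN : i ≤ N) :
    lobattoNode N i = ((lobattoPoly N).roots.sort (· ≤ ·))[i - 1]'(by
      rw [length_sort_lobattoPoly hN]; omega) := by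
  rw [lobattoNode, List.getD_eq_getElem]

theorem isRoot_lobattoNode (hN : 2 ≤ N) {i : ℕ} (hi : 1 ≤ i) (hiN : i ≤ N) :
    (lobattoPoly N).IsRoot (lobattoNode N i) := by
  refine isRoot_of_mem_roots ?_
  rw [← Multiset.mem_sort (r := (· ≤ ·)), lobattoNode_eq_getElem hN hi hiN]
  exact List.getElem_mem _

theorem lobattoNode_lt (hN : 2 ≤ N) {i j : ℕ} (hi : 1 ≤ i) (hij : i < j) (hjN : j ≤ N) :
    lobattoNode N i < lobattoNode N j := by
  rw [lobattoNode_eq_getElem hN hi (by omega), lobattoNode_eq_getElem hN (by omega) hjN]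
  have h1 := Multiset.pairwise_sort (lobattoPoly N).roots (· ≤ ·)
  have h2 : ((lobattoPoly N).roots.sort (· ≤ ·)).Nodup := by
    rw [← Multiset.coe_nodup, Multiset.sort_eq]
    exact (lobattoPoly_card_roots hN).2.1
  refine lt_of_le_of_ne (List.pairwise_iff_getElem.1 h1 _ _ _ _ (by omega)) ?_
  intro h
  have := (h2.getElem_inj_iff).1 h
  omega

theorem lobattoNode_injOn (hN : 2 ≤ N) : Set.InjOn (lobattoNode N) (Finset.Icc 1 N) := by
  intro i hi j hj h
  simp only [Finset.coe_Icc, Set.mem_Icc] at hi hj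
  rcases lt_trichotomy i j with hij | hij | hij
  · exact absurd h (lobattoNode_lt hN hi.1 hij hj.2).ne
  · exact hij
  · exact absurd h (lobattoNode_lt hN hj.1 hij hi.2).ne'

theorem exists_lobattoNode_eq (hN : 2 ≤ N) {x : ℝ} (hx : (lobattoPoly N).IsRoot x) :
    ∃ i, 1 ≤ i ∧ i ≤ N ∧ lobattoNode N i = x := by
  have h1 : x ∈ (lobattoPoly N).roots.sort (· ≤ ·) := by
    rw [Multiset.mem_sort, mem_roots (lobattoPoly_card_roots hN).2.2.2]
    exact hx
  obtain ⟨k, hk, h⟩ := List.mem_iff_getElem.1 h1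
  have hk' := hk
  rw [length_sort_lobattoPoly hN] at hk'
  exact ⟨k + 1, by omega, by omega, by
    rw [lobattoNode_eq_getElem hN (by omega) (by omega)]; simpa using h⟩

/-- The point 0 is a root and Gauss–Lucas leaves no root below it. -/
theorem lobattoNode_one (hN : 2 ≤ N) : lobattoNode N 1 = 0 := by
  obtain ⟨i, h1, h2, h3⟩ := exists_lobattoNode_eq hN
    (eval_zero_iterate_derivative_lobattoBase (M := N - 1) (j := N - 2) (by omega))
  have h4 := (mem_Icc_of_isRoot_lobattoPoly hN (isRoot_lobattoNode hN le_rfl (by omega))).1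
  rcases h1.eq_or_lt with h | h
  · rwa [h]
  · have := lobattoNode_lt hN le_rfl h h2
    linarith

theorem lobattoNode_self (hN : 2 ≤ N) : lobattoNode N N = 1 := by
  obtain ⟨i, h1, h2, h3⟩ := exists_lobattoNode_eq hN
    (eval_one_iterate_derivative_lobattoBase (M := N - 1) (j := N - 2) (by omega))
  have h4 := (mem_Icc_of_isRoot_lobattoPoly hN (isRoot_lobattoNode hN (by omega) le_rfl)).2
  rcases h2.eq_or_lt with h | h
  · rwa [h] at h3
  · have := lobattoNode_lt hN h1 h le_rfl
    linarith

/-! ### Orthogonality and exactness of the quadrature rule. -/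

theorem intervalIntegrable_eval (f : ℝ[X]) (a b : ℝ) :
    IntervalIntegrable (fun t => f.eval t) MeasureTheory.volume a b :=
  f.continuous.intervalIntegrable a b

/-- The `j`-th derivative of `x^M (x-1)^M` is orthogonal to polynomials of degree less than `j`. -/
theorem integral_iterate_derivative_mul_eq_zero {M j : ℕ} (h : j ≤ M) (q : ℝ[X])
    (hq : q.degree < j) :
    ∫ t in (0 : ℝ)..1, (derivative^[j] (lobattoBase M) * q).eval t = 0 := by
  induction j generalizing q with
  | zero =>
    have : q = 0 := by
      rw [← degree_eq_bot]
      exact Nat.WithBot.lt_zero_iff.1 (by simpa using hq)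
    simp [this]
  | succ j ih =>
    have h1 := intervalIntegral.integral_mul_deriv_eq_deriv_mul
      (a := (0 : ℝ)) (b := 1) (u := fun t => q.eval t)
      (v := fun t => (derivative^[j] (lobattoBase M)).eval t)
      (u' := fun t => (derivative q).eval t)
      (v' := fun t => (derivative^[j + 1] (lobattoBase M)).eval t)
      (fun x _ => q.hasDerivAt x)
      (fun x _ => by
        rw [Function.iterate_succ_apply']
        exact (derivative^[j] (lobattoBase M)).hasDerivAt x)
      (intervalIntegrable_eval _ _ _) (intervalIntegrable_eval _ _ _)
    rw [eval_one_iterate_derivative_lobattoBase (by omega),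
      eval_zero_iterate_derivative_lobattoBase (by omega)] at h1
    have h2 : (derivative q).degree < (j : WithBot ℕ) := by
      rcases eq_or_ne q 0 with rfl | hq0
      · simp
      · rcases eq_or_ne (derivative q) 0 with h0 | h0
        · rw [h0, degree_zero]; exact WithBot.bot_lt_coe j
        · have h4 := degree_derivative_lt hq0
          rw [degree_eq_natDegree h0, degree_eq_natDegree hq0] at h4
          rw [degree_eq_natDegree hq0] at hq
          rw [degree_eq_natDegree h0]
          norm_cast at h4 hq ⊢
          omega
    have h3 := ih (by omega) _ h2
    simp only [eval_mul] at h3 ⊢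
    simp only [mul_comm] at h1 h3 ⊢
    rw [h1, h3]
    simp

/-- The `N`-point Gauss-Lobatto rule is exact for polynomials of degree at most `2N-3`. -/
theorem sum_lobattoWeight_mul_eval (hN : 3 ≤ N) (f : ℝ[X]) (hf : f.natDegree ≤ 2 * N - 3) :
    ∑ i ∈ Finset.Icc 1 N, lobattoWeight N i * f.eval (lobattoNode N i) =
      ∫ t in (0 : ℝ)..1, f.eval t := by
  obtain ⟨-, -, hdeg, h0⟩ := lobattoPoly_card_roots (N := N) (by omega)
  have h1 := EuclideanDomain.div_add_mod f (lobattoPoly N)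
  set q := f / lobattoPoly N with hq
  set r := f % lobattoPoly N with hr
  have hrd : r.degree < (Finset.Icc 1 N).card := by
    rw [Nat.card_Icc, Nat.add_sub_cancel]
    have := degree_mod_lt f h0
    rwa [degree_eq_natDegree h0, hdeg] at this
  -- Dividing f by the Lobatto polynomial of degree N leaves a quotient of degree at most N-3,
  -- orthogonal to that polynomial; the remainder is integrated exactly by interpolation.
  have hqd : q.degree < ((N - 2 : ℕ) : WithBot ℕ) := by
    rcases eq_or_ne q 0 with h | h
    · rw [h, degree_zero]; exact WithBot.bot_lt_coe _
    · have h2 : (lobattoPoly N).degree ≤ f.degree := by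
        by_contra h2
        exact h ((Polynomial.div_eq_zero_iff h0).2 (not_le.1 h2))
      have h3 := degree_add_div h0 h2
      have hf0 : f ≠ 0 := by
        rintro rfl
        simp [hq] at h
      rw [degree_eq_natDegree h0, degree_eq_natDegree h, degree_eq_natDegree hf0] at h3
      rw [degree_eq_natDegree h]
      norm_cast at h3 ⊢
      omega
  have hint := integral_iterate_derivative_mul_eq_zero (M := N - 1) (j := N - 2) (by omega) q hqd
  rw [← lobattoPoly_eq] at hint
  have hfr : ∫ t in (0 : ℝ)..1, f.eval t = ∫ t in (0 : ℝ)..1, r.eval t := by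
    rw [← h1]
    simp only [eval_add]
    rw [intervalIntegral.integral_add (intervalIntegrable_eval _ _ _)
      (intervalIntegrable_eval _ _ _), hint, zero_add]
  have hr2 := Lagrange.eq_interpolate (lobattoNode_injOn (N := N) (by omega)) hrd
  have hev : ∀ i ∈ Finset.Icc 1 N, f.eval (lobattoNode N i) = r.eval (lobattoNode N i) := by
    intro i hi
    rw [Finset.mem_Icc] at hi
    conv_lhs => rw [← h1]
    rw [eval_add, eval_mul, (isRoot_lobattoNode (by omega) hi.1 hi.2).eq_zero, zero_mul, zero_add]
  rw [hfr, hr2, Lagrange.interpolate_apply]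
  simp only [eval_finsetSum, eval_mul, eval_C]
  rw [intervalIntegral.integral_finsetSum]
  · refine Finset.sum_congr rfl fun i hi => ?_
    rw [hev i hi, intervalIntegral.integral_const_mul, lobattoWeight, mul_comm]
  · intro i _
    exact (intervalIntegrable_eval _ _ _).const_mul _

theorem sum_lobattoWeight_mul_pow (hN : 3 ≤ N) {k : ℕ} (hk : k ≤ 2 * N - 3) :
    ∑ i ∈ Finset.Icc 1 N, lobattoWeight N i * lobattoNode N i ^ k = 1 / ((k : ℝ) + 1) := by
  have h := sum_lobattoWeight_mul_eval hN (X ^ k) (by rwa [natDegree_X_pow])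
  simpa using h

/-- The rule is tested on a polynomial of the maximal degree 2N-3 that vanishes at every node but
the last and has positive integral. The result is needed because the last row occurs in every
Vandermonde system of the D-part, multiplied by w_N. -/
theorem lobattoWeight_self_ne_zero (hN : 3 ≤ N) : lobattoWeight N N ≠ 0 := by
  set f : ℝ[X] := X * ∏ i ∈ Finset.Icc 2 (N - 1), (X - C (lobattoNode N i)) ^ 2 with hf
  have hfd : f.natDegree ≤ 2 * N - 3 := by
    have h1 := natDegree_prod_le (Finset.Icc 2 (N - 1))
      (fun i => (X - C (lobattoNode N i)) ^ 2)
    refine natDegree_mul_le.trans ?_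
    rw [natDegree_X]
    simp only [natDegree_pow, natDegree_X_sub_C, Finset.sum_const, Nat.card_Icc,
      smul_eq_mul] at h1
    omega
  have hev : ∀ t, f.eval t = t * ∏ i ∈ Finset.Icc 2 (N - 1), (t - lobattoNode N i) ^ 2 := by
    intro t
    simp [hf, eval_prod]
  have h1 := sum_lobattoWeight_mul_eval hN f hfd
  rw [Finset.sum_eq_single N] at h1
  · intro h
    rw [h, zero_mul] at h1
    refine (intervalIntegral.integral_pos (a := (0 : ℝ)) (b := 1) one_pos
      f.continuous.continuousOn ?_ ⟨1, by simp, ?_⟩).ne h1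
    · intro x hx
      rw [hev]
      exact mul_nonneg hx.1.le (Finset.prod_nonneg fun i _ => sq_nonneg _)
    · rw [hev, one_mul]
      refine Finset.prod_pos fun i hi => ?_
      rw [Finset.mem_Icc] at hi
      have h2 := lobattoNode_lt (N := N) (by omega) (i := i) (j := N) (by omega) (by omega) le_rfl
      rw [lobattoNode_self (by omega)] at h2
      have : 1 - lobattoNode N i ≠ 0 := by linarith
      positivity
  · intro i hi hiN
    rw [Finset.mem_Icc] at hi
    rw [hev]
    rcases hi.1.eq_or_lt with h | h
    · rw [← h, lobattoNode_one (by omega), zero_mul, mul_zero]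
    · rw [Finset.prod_eq_zero (i := i) (Finset.mem_Icc.2 ⟨h, by omega⟩) (by simp), mul_zero,
        mul_zero]
  · intro h
    exact absurd (Finset.mem_Icc.2 ⟨by omega, le_rfl⟩) h

end Lobatto

/-! ### Numbering of the stages -/

section Index

/-- Triangular numbers. -/
def tri (k : ℕ) : ℕ := k * (k - 1) / 2

theorem tri_succ (k : ℕ) : tri (k + 1) = tri k + k := by
  have h1 : tri (k + 1) = ∑ i ∈ Finset.range (k + 1), i := (Finset.sum_range_id (k + 1)).symm
  have h2 : tri k = ∑ i ∈ Finset.range k, i := (Finset.sum_range_id k).symm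
  rw [h1, h2, Finset.sum_range_succ]

theorem tri_zero : tri 0 = 0 := rfl

theorem tri_one : tri 1 = 0 := rfl

theorem tri_mono : Monotone tri := monotone_nat_of_le_succ fun k => by rw [tri_succ]; omega

theorem le_tri_succ (k : ℕ) : k ≤ tri (k + 1) := by rw [tri_succ]; omega

theorem mul_succ_div_two (k : ℕ) : k * (k + 1) / 2 = tri (k + 1) := by
  rw [tri, Nat.add_sub_cancel, mul_comm]

theorem pred_mul_div_two (k : ℕ) : (k - 1) * (k - 2) / 2 = tri (k - 1) := by
  rw [tri, Nat.sub_sub]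

theorem mul_pred_div_two (k : ℕ) : k * (k - 1) / 2 = tri k := rfl

/-- The number `g` of the block `tri g < x ≤ tri (g + 1)` containing `x`. -/
def block (x : ℕ) : ℕ := Nat.findGreatest (fun g => tri g < x) x

/-- The search bound x in `block` is harmless since k-1 ≤ tri k. The case k = 0 must be excluded: it
would fail at x = 0. -/
theorem le_block_iff {k x : ℕ} (hk : 1 ≤ k) : k ≤ block x ↔ tri k < x := by
  constructor
  · intro h
    have h1 : block x ≠ 0 := by omega
    have h2 := Nat.findGreatest_of_ne_zero (P := fun g => tri g < x) rfl h1
    exact (tri_mono h).trans_lt h2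
  · intro h
    have h1 := le_tri_succ (k - 1)
    rw [Nat.sub_add_cancel hk] at h1
    exact Nat.le_findGreatest (by omega) h

theorem block_mono : Monotone block := by
  intro x y h
  rcases Nat.eq_zero_or_pos (block x) with h0 | h0
  · omega
  · rw [le_block_iff h0]
    exact ((le_block_iff h0).1 le_rfl).trans_le h

variable {p : ℕ}

theorem stages_eq : stages p = 1 + lOf p + tri (nOf p + 1) := by
  rw [stages, mul_succ_div_two]

theorem lOf_eq : lOf p = tri (mOf p) := rfl

theorem NOf_eq : NOf p = nOf p + 1 := rfl

theorem nOf_eq [hp : Fact (4 ≤ p)] : nOf p = mOf p + 1 := by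
  have := hp.out
  unfold nOf mOf
  omega

theorem one_le_mOf [hp : Fact (4 ≤ p)] : 1 ≤ mOf p := by
  have := hp.out
  unfold mOf
  omega

theorem one_le_stg {s : ℕ} (i : Fin s) : 1 ≤ stg i := Nat.le_add_left 1 _

theorem stg_le {s : ℕ} (i : Fin s) : stg i ≤ s := i.isLt

theorem stg_injective {s : ℕ} : Function.Injective (stg (s := s)) := fun _ _ h =>
  Fin.ext (Nat.add_right_cancel h)

/-- The index with stage number `x`. -/
def stageAt (p x : ℕ) : Fin (stages p) :=
  ⟨min (x - 1) (stages p - 1), by rw [stages]; omega⟩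

theorem stg_stageAt {x : ℕ} (h1 : 1 ≤ x) (h2 : x ≤ stages p) : stg (stageAt p x) = x := by
  simp only [stg, stageAt]
  omega

/-- The level of a stage: `0` for the first one, `g` in the `g`-th `Q`-group. -/
def lev (i : Fin (stages p)) : ℕ := block (stg i - 1)

/-- The colevel of a stage: `0` for the last one, `j` in the `j`-th `D`-group, `n` for ghosts. -/
def colev (i : Fin (stages p)) : ℕ := block (stages p - stg i)

/-- The stages `l + 2, …, s`. -/
abbrev Outer (i : Fin (stages p)) : Prop := lOf p + 2 ≤ stg i

/-- The position in the `D`-group or in the ghost group; `0` for the last stage. -/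
def rk (i : Fin (stages p)) : ℕ :=
  if colev i = 0 then 0 else
    if colev i < nOf p then stg i + tri (colev i + 1) + 1 - stages p else stg i - (lOf p + 1)

theorem le_lev_iff {i : Fin (stages p)} {k : ℕ} (hk : 1 ≤ k) :
    k ≤ lev i ↔ tri k + 2 ≤ stg i := by
  rw [lev, le_block_iff hk]
  omega

theorem le_colev_iff {i : Fin (stages p)} {k : ℕ} (hk : 1 ≤ k) :
    k ≤ colev i ↔ stg i + tri k + 1 ≤ stages p := by
  rw [colev, le_block_iff hk]
  omega

theorem lev_eq_zero_iff {i : Fin (stages p)} : lev i = 0 ↔ stg i = 1 := by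
  have := le_lev_iff (i := i) le_rfl
  have := one_le_stg i
  rw [tri_one] at *
  omega

theorem colev_eq_zero_iff {i : Fin (stages p)} : colev i = 0 ↔ stg i = stages p := by
  have := le_colev_iff (i := i) le_rfl
  have := stg_le i
  rw [tri_one] at *
  omega

theorem lev_eq_iff {i : Fin (stages p)} {k : ℕ} (hk : 1 ≤ k) :
    lev i = k ↔ tri k + 2 ≤ stg i ∧ stg i ≤ tri (k + 1) + 1 := by
  have h1 := le_lev_iff (i := i) hk
  have h2 := le_lev_iff (i := i) (k := k + 1) (by omega)
  omega

theorem colev_eq_iff {i : Fin (stages p)} {k : ℕ} (hk : 1 ≤ k) :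
    colev i = k ↔ stg i + tri k + 1 ≤ stages p ∧ stages p ≤ stg i + tri (k + 1) := by
  have h1 := le_colev_iff (i := i) hk
  have h2 := le_colev_iff (i := i) (k := k + 1) (by omega)
  omega

theorem colev_le {i : Fin (stages p)} (h : Outer i) : colev i ≤ nOf p := by
  have h1 := le_colev_iff (i := i) (k := nOf p + 1) (by omega)
  have h2 := stages_eq (p := p)
  omega

theorem rk_eq_zero_iff {i : Fin (stages p)} (hi : Outer i) : rk i = 0 ↔ colev i = 0 := by
  rw [rk]
  split_ifs with h1 h2
  · simp [h1]
  · have e1 := (colev_eq_iff (i := i) (by omega)).1 rfl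
    omega
  · omega

theorem rk_le_colev {i : Fin (stages p)} (h : colev i < nOf p) : rk i ≤ colev i := by
  rw [rk]
  split_ifs with h1
  · omega
  · have e1 := (colev_eq_iff (i := i) (by omega)).1 rfl
    rw [tri_succ] at *
    omega

/-- Colevel and rank serve as coordinates on the outer stages: the colevel selects the D-group or
ghost group, the rank selects the Lobatto point. -/
theorem eq_of_colev_eq_of_rk_eq {i j : Fin (stages p)} (hi : Outer i) (hj : Outer j)
    (h : colev i = colev j) (h' : rk i = rk j) : i = j := by
  apply stg_injective
  rw [rk, rk, h] at h'
  split_ifs at h' with h1 h2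
  · rw [colev_eq_zero_iff.1 h1, colev_eq_zero_iff.1 (h.trans h1)]
  · have e1 := (colev_eq_iff (i := i) (k := colev j) (by omega)).1 h
    have e2 := (colev_eq_iff (i := j) (by omega)).1 rfl
    omega
  · omega

theorem card_filter_stg {s a b : ℕ} (ha : 1 ≤ a) (hb : b ≤ s) :
    (Finset.univ.filter fun i : Fin s => a ≤ stg i ∧ stg i ≤ b).card = b + 1 - a := by
  rw [← Nat.card_Icc]
  refine Finset.card_bij (fun i _ => stg i) ?_ (fun _ _ _ _ h => stg_injective h) ?_
  · intro i hi
    simpa using hi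
  · intro x hx
    rw [Finset.mem_Icc] at hx
    have h : stg (⟨x - 1, by omega⟩ : Fin s) = x := by simp only [stg]; omega
    exact ⟨⟨x - 1, by omega⟩, by simpa [h] using hx, h⟩

/-- The columns of the Vandermonde system for a row of level `g`. -/
def QNodes (p g : ℕ) : Finset (Fin (stages p)) :=
  Finset.univ.filter fun j => lev j = 0 ∨ lev j = g - 1

/-- The rows of the Vandermonde system for a column of colevel `g`. -/
def DNodes (p g : ℕ) : Finset (Fin (stages p)) :=
  Finset.univ.filter fun i => colev i = 0 ∨ colev i = g - 1

theorem card_filter_lev {g : ℕ} (h1 : 1 ≤ g) (h2 : g < mOf p) :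
    (Finset.univ.filter fun i : Fin (stages p) => lev i = g).card = g := by
  have e2 := stages_eq (p := p)
  have e3 := tri_succ g
  have e4 := tri_mono (a := g + 1) (b := mOf p) h2
  have := card_filter_stg (s := stages p) (a := tri g + 2) (b := tri (g + 1) + 1) (by omega)
    (by rw [lOf_eq] at e2; omega)
  rw [Finset.filter_congr (q := fun i => tri g + 2 ≤ stg i ∧ stg i ≤ tri (g + 1) + 1), this]
  · omega
  · intro i _
    rw [lev_eq_iff h1]

theorem card_QNodes {g : ℕ} (h1 : 1 ≤ g) (h2 : g ≤ mOf p) : (QNodes p g).card = g := by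
  have e2 := stages_eq (p := p)
  have e0 : (Finset.univ.filter fun i : Fin (stages p) => lev i = 0).card = 1 := by
    have := card_filter_stg (s := stages p) (a := 1) (b := 1) le_rfl (by omega)
    rw [Nat.add_sub_cancel] at this
    rw [← this]
    congr 1
    ext i
    simp only [Finset.mem_filter, Finset.mem_univ, true_and, lev_eq_zero_iff]
    omega
  rcases h1.eq_or_lt with h | h
  · subst h
    rw [QNodes]
    simpa using e0
  · rw [QNodes, Finset.filter_or, Finset.card_union_of_disjoint, e0,
      card_filter_lev (by omega) (by omega)]
    · omega
    · rw [Finset.disjoint_filter]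
      intro i _ _
      omega

/-- The last stage together with the g-1 stages of the preceding D-group; for g = 1 the two
alternatives coincide. This count makes the D-part square. -/
theorem card_DNodes {g : ℕ} (h1 : 1 ≤ g) (h2 : g ≤ nOf p) : (DNodes p g).card = g := by
  have e2 := stages_eq (p := p)
  have e0 : (Finset.univ.filter fun i : Fin (stages p) => colev i = 0).card = 1 := by
    have := card_filter_stg (s := stages p) (a := stages p) (b := stages p) (by omega) le_rfl
    rw [Nat.add_sub_cancel_left] at this
    rw [← this]
    congr 1
    ext i
    simp only [Finset.mem_filter, Finset.mem_univ, true_and, colev_eq_zero_iff]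
    omega
  rcases h1.eq_or_lt with h | h
  · subst h
    rw [DNodes]
    simpa using e0
  · rw [DNodes, Finset.filter_or, Finset.card_union_of_disjoint, e0]
    · have e3 := tri_succ (g - 1)
      have e4 := tri_mono (a := g) (b := nOf p + 1) (by omega)
      rw [Nat.sub_add_cancel h1] at e3
      have := card_filter_stg (s := stages p) (a := stages p - tri g)
        (b := stages p - 1 - tri (g - 1)) (by omega) (by omega)
      rw [Finset.filter_congr (q := fun i => stages p - tri g ≤ stg i ∧
        stg i ≤ stages p - 1 - tri (g - 1)), this]
      · omega
      · intro i _
        rw [colev_eq_iff (by omega), Nat.sub_add_cancel h1]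
        omega
    · rw [Finset.disjoint_filter]
      intro i _ _
      omega

/-- The node cluster number `r`. -/
def Cl (p r : ℕ) : Finset (Fin (stages p)) := Finset.univ.filter fun i => Outer i ∧ rk i = r

theorem mem_Cl {r : ℕ} {i : Fin (stages p)} : i ∈ Cl p r ↔ Outer i ∧ rk i = r := by
  simp [Cl]

theorem InQGroup_iff {g : ℕ} (hg : 1 ≤ g) {i : Fin (stages p)} :
    InQGroup g (stg i) ↔ lev i = g := by
  rw [lev_eq_iff hg, InQGroup, mul_succ_div_two, mul_pred_div_two]

theorem IsStageVector.ne_zero {c : Fin (stages p) → ℝ} (hc : IsStageVector p c) {i : Fin (stages p)}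
    (h1 : 1 ≤ lev i) (h2 : lev i < mOf p) : c i ≠ 0 :=
  hc.qGroup_ne_zero (lev i) i h1 (by omega) ((InQGroup_iff h1).2 rfl)

variable [hp : Fact (4 ≤ p)]

theorem outer_iff {i : Fin (stages p)} : Outer i ↔ mOf p ≤ lev i := by
  rw [le_lev_iff one_le_mOf, Outer, lOf_eq]

theorem outer_of_colev_lt {i : Fin (stages p)} (h : colev i < nOf p) : Outer i := by
  have h1 := le_colev_iff (i := i) (k := nOf p) (by rw [nOf_eq]; omega)
  have h2 := stages_eq (p := p)
  rw [tri_succ] at h2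
  have h3 := nOf_eq (p := p)
  have h4 := one_le_mOf (p := p)
  omega

/-- The first column is level 0, and the k-th rectangle consists of the columns of level k-1 and the
rows of level at least k. -/
theorem mem_IQ_iff {i j : Fin (stages p)} :
    (stg i, stg j) ∈ IQ p ↔ lev j < mOf p ∧ lev j < lev i := by
  have hm := one_le_mOf (p := p)
  have h0 := lev_eq_zero_iff (i := i)
  have h0' := lev_eq_zero_iff (i := j)
  have hi := one_le_stg i
  have hi' := stg_le i
  simp only [IQ, Set.mem_union, Set.mem_ofPred_eq, mul_pred_div_two, pred_mul_div_two]
  constructor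
  · rintro (⟨h1, h2, h3⟩ | ⟨k, h1, h2, h3, h4, h5, h6⟩)
    · omega
    · have e1 : lev j = k - 1 := by
        rw [lev_eq_iff (by omega), Nat.sub_add_cancel (by omega)]
        exact ⟨h5, h6⟩
      have e2 : k ≤ lev i := by rw [le_lev_iff (by omega)]; exact h3
      omega
  · rintro ⟨h1, h2⟩
    rcases Nat.eq_zero_or_pos (lev j) with h3 | h3
    · left; omega
    · right
      have e1 := (lev_eq_iff (i := j) h3).1 rfl
      have e2 := (le_lev_iff (i := i) (k := lev j + 1) (by omega)).1 (by omega)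
      exact ⟨lev j + 1, by omega, by omega, e2, hi', by simpa using e1.1, e1.2⟩

/-- The last row is colevel 0, and the k-th rectangle consists of the rows of colevel k-1 and the
outer columns of colevel at least k. Ghost rows, of colevel n, have no such entries. -/
theorem mem_ID_iff {i j : Fin (stages p)} :
    (stg i, stg j) ∈ ID p ↔ Outer j ∧ colev i < nOf p ∧ colev i < colev j := by
  have hm := one_le_mOf (p := p)
  have hn := nOf_eq (p := p)
  have h0 := colev_eq_zero_iff (i := i)
  have h0' := colev_eq_zero_iff (i := j)
  have hi := stg_le j
  have hi' := stg_le i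
  simp only [ID, Set.mem_union, Set.mem_ofPred_eq, mul_pred_div_two, pred_mul_div_two]
  constructor
  · rintro (⟨h1, h2, h3⟩ | ⟨k, h1, h2, h3, h4, h5, h6⟩)
    · omega
    · have e0 := tri_mono (a := k - 1) (b := k) (by omega)
      have e1 : colev i = k - 1 := by
        rw [colev_eq_iff (by omega), Nat.sub_add_cancel (by omega)]
        omega
      have e2 : k ≤ colev j := by rw [le_colev_iff (by omega)]; omega
      omega
  · rintro ⟨h1, h2, h3⟩
    rcases Nat.eq_zero_or_pos (colev i) with h4 | h4
    · left; omega
    · right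
      have e1 := (colev_eq_iff (i := i) h4).1 rfl
      have e2 := (le_colev_iff (i := j) (k := colev i + 1) (by omega)).1 (by omega)
      exact ⟨colev i + 1, by omega, by omega, by omega, by
        rw [Nat.add_sub_cancel]; omega, h1, by omega⟩

theorem rk_le {i : Fin (stages p)} (hi : Outer i) : rk i ≤ mOf p := by
  have hn := nOf_eq (p := p)
  by_cases h : colev i < nOf p
  · have := rk_le_colev h
    omega
  · have e1 := (colev_eq_iff (i := i) (k := nOf p) (by omega)).1 (by have := colev_le hi; omega)
    rw [rk, if_neg (by omega), if_neg h]
    have e2 := stages_eq (p := p)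
    rw [tri_succ] at e2
    omega

theorem ghostPos_spec {r : ℕ} (h1 : 1 ≤ r) (h2 : r ≤ mOf p) :
    stg (stageAt p (ghostPos p r)) = ghostPos p r ∧ Outer (stageAt p (ghostPos p r)) ∧
      colev (stageAt p (ghostPos p r)) = nOf p ∧ rk (stageAt p (ghostPos p r)) = r := by
  have hn := nOf_eq (p := p)
  have e2 := stages_eq (p := p)
  have e3 := tri_succ (nOf p)
  have h3 : stg (stageAt p (ghostPos p r)) = ghostPos p r :=
    stg_stageAt (by rw [ghostPos]; omega) (by rw [ghostPos]; omega)
  have h4 : colev (stageAt p (ghostPos p r)) = nOf p := by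
    rw [colev_eq_iff (by omega), h3, ghostPos]
    omega
  refine ⟨h3, by rw [Outer, h3, ghostPos]; omega, h4, ?_⟩
  rw [rk, h4, if_neg (by omega), if_neg (by omega), h3, ghostPos]
  omega

theorem dPos_spec {j r : ℕ} (h1 : 1 ≤ r) (h2 : r ≤ j) (h3 : j ≤ mOf p) :
    stg (stageAt p (dPos p j r)) = dPos p j r ∧ Outer (stageAt p (dPos p j r)) ∧
      colev (stageAt p (dPos p j r)) = j ∧ rk (stageAt p (dPos p j r)) = r := by
  have hn := nOf_eq (p := p)
  have e2 := stages_eq (p := p)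
  have e3 := tri_succ (nOf p)
  have e4 := tri_succ j
  have e5 := tri_mono (a := j + 1) (b := nOf p) (by omega)
  have e6 : dPos p j r = stages p - 1 - tri (j + 1) + r := by rw [dPos, mul_succ_div_two]
  have e7 : stg (stageAt p (dPos p j r)) = dPos p j r :=
    stg_stageAt (by omega) (by omega)
  have e8 : colev (stageAt p (dPos p j r)) = j := by
    rw [colev_eq_iff (by omega), e7, e6]
    omega
  refine ⟨e7, outer_of_colev_lt (by omega), e8, ?_⟩
  rw [rk, e8, if_neg (by omega), if_pos (by omega), e7, e6]
  omega

/-- The ghost stage in the cluster number `r`. -/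
def ghost (p r : ℕ) : Fin (stages p) := stageAt p (ghostPos p r)

theorem eq_ghost {i : Fin (stages p)} (hi : Outer i) (h : colev i = nOf p) :
    i = ghost p (rk i) := by
  have h1 : rk i ≠ 0 := by rw [Ne, rk_eq_zero_iff hi, h, nOf_eq]; omega
  obtain ⟨-, e2, e3, e4⟩ := ghostPos_spec (p := p) (r := rk i) (by omega) (rk_le hi)
  exact eq_of_colev_eq_of_rk_eq hi e2 (h.trans e3.symm) e4.symm

theorem stg_eq_dPos {i : Fin (stages p)} (h1 : 1 ≤ colev i) (h2 : colev i < nOf p) :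
    stg i = dPos p (colev i) (rk i) := by
  have hi := outer_of_colev_lt h2
  have h3 : rk i ≠ 0 := by rw [Ne, rk_eq_zero_iff hi]; omega
  have hn := nOf_eq (p := p)
  obtain ⟨e1, e2, e3, e4⟩ := dPos_spec (p := p) (j := colev i) (r := rk i) (by omega)
    (rk_le_colev h2) (by omega)
  rw [← e1]
  exact congrArg stg (eq_of_colev_eq_of_rk_eq hi e2 e3.symm e4.symm)

theorem stg_eq_ghostPos {i : Fin (stages p)} (hi : Outer i) (h : colev i = nOf p) :
    stg i = ghostPos p (rk i) := by
  have h1 : rk i ≠ 0 := by rw [Ne, rk_eq_zero_iff hi, h, nOf_eq]; omega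
  have := congrArg stg (eq_ghost hi h)
  rwa [ghost, (ghostPos_spec (by omega) (rk_le hi)).1] at this

variable {c : Fin (stages p) → ℝ}

theorem IsStageVector.outer (hc : IsStageVector p c) {i : Fin (stages p)} (hi : Outer i) :
    c i = lobattoNode (NOf p) (NOf p - rk i) := by
  have hn := nOf_eq (p := p)
  rcases Nat.eq_zero_or_pos (colev i) with h | h
  · rw [(rk_eq_zero_iff hi).2 h, hc.last i (colev_eq_zero_iff.1 h), Nat.sub_zero]
  have h3 : rk i ≠ 0 := by rw [Ne, rk_eq_zero_iff hi]; omega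
  by_cases h' : colev i < nOf p
  · exact hc.dGroup i (colev i) (rk i) (by omega) (rk_le_colev h') (by rw [NOf_eq]; omega)
      (stg_eq_dPos h h')
  · exact hc.ghost i (rk i) (by omega) (by have := rk_le hi; rw [NOf_eq]; omega)
      (stg_eq_ghostPos hi (by have := colev_le hi; omega))

theorem two_le_NOf : 2 ≤ NOf p := by
  rw [NOf_eq, nOf_eq]
  omega

theorem three_le_NOf : 3 ≤ NOf p := by
  have := one_le_mOf (p := p)
  rw [NOf_eq, nOf_eq]
  omega

theorem IsStageVector.first_eq_zero (hc : IsStageVector p c) {i : Fin (stages p)}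
    (hi : lev i = 0) : c i = 0 := by
  rw [hc.first i (lev_eq_zero_iff.1 hi), lobattoNode_one two_le_NOf]

theorem IsStageVector.injOn_QNodes (hc : IsStageVector p c) {g : ℕ} (h2 : g ≤ mOf p) :
    Set.InjOn c (QNodes p g) := by
  intro i hi j hj h
  simp only [QNodes, Finset.coe_filter, Finset.mem_univ, true_and, Set.mem_ofPred_eq] at hi hj
  have hm := one_le_mOf (p := p)
  by_cases h1 : lev i = 0
  · by_cases h3 : lev j = 0
    · exact stg_injective ((lev_eq_zero_iff.1 h1).trans (lev_eq_zero_iff.1 h3).symm)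
    · rw [hc.first_eq_zero h1] at h
      exact absurd h.symm (hc.ne_zero (by omega) (by omega))
  · by_cases h3 : lev j = 0
    · rw [hc.first_eq_zero h3] at h
      exact absurd h (hc.ne_zero (by omega) (by omega))
    · by_contra hij
      exact hc.qGroup_distinct (lev i) i j (by omega) (by omega) ((InQGroup_iff (by omega)).2 rfl)
        ((InQGroup_iff (by omega)).2 (by omega)) hij h

theorem IsStageVector.rk_eq (hc : IsStageVector p c) {i j : Fin (stages p)} (hi : Outer i)
    (hj : Outer j) (h : c i = c j) : rk i = rk j := by
  rw [hc.outer hi, hc.outer hj] at h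
  have h1 := rk_le hi
  have h2 := rk_le hj
  have h3 := nOf_eq (p := p)
  have h4 := NOf_eq (p := p)
  have := lobattoNode_injOn two_le_NOf (by simp; omega) (by simp; omega) h
  omega

theorem IsStageVector.injOn_DNodes (hc : IsStageVector p c) {g : ℕ} (h1 : 1 ≤ g)
    (h2 : g ≤ nOf p) : Set.InjOn c (DNodes p g) := by
  intro i hi j hj h
  simp only [DNodes, Finset.coe_filter, Finset.mem_univ, true_and, Set.mem_ofPred_eq] at hi hj
  have hn := nOf_eq (p := p)
  have hoi : Outer i := outer_of_colev_lt (by omega)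
  have hoj : Outer j := outer_of_colev_lt (by omega)
  have hr := hc.rk_eq hoi hoj h
  refine eq_of_colev_eq_of_rk_eq hoi hoj ?_ hr
  have e1 := rk_eq_zero_iff hoi
  have e2 := rk_eq_zero_iff hoj
  omega

theorem IsStageVector.cluster_eq (hc : IsStageVector p c) {r : ℕ} (hr : r ≤ mOf p) :
    cluster (lOf p) c (lobattoNode (NOf p) (NOf p - r)) = Cl p r := by
  ext i
  simp only [cluster, Cl, Finset.mem_filter, Finset.mem_univ, true_and]
  refine and_congr_right fun hi => ?_
  rw [hc.outer hi]
  constructor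
  · intro h
    have h1 := rk_le hi
    have h3 := nOf_eq (p := p)
    have h4 := NOf_eq (p := p)
    have := lobattoNode_injOn two_le_NOf (by simp; omega) (by simp; omega) h
    omega
  · rintro rfl; rfl

end Index

/-! ### Vandermonde systems -/

section Vandermonde

variable {ι : Type*} (S : Finset ι) (x : ι → ℝ)

/-- The moments vanish on all polynomials of degree below |S|, in particular on the Lagrange basis,
which isolates each coefficient. -/
theorem eq_zero_of_sum_mul_pow_eq_zero (hx : Set.InjOn x S) (a : ι → ℝ)
    (h : ∀ k < S.card, ∑ i ∈ S, a i * x i ^ k = 0) : ∀ i ∈ S, a i = 0 := by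
  classical
  intro j hj
  have h1 : ∀ f : ℝ[X], f.degree < S.card → ∑ i ∈ S, a i * f.eval (x i) = 0 := by
    intro f hf
    have h2 : ∀ i, f.eval (x i) = ∑ k ∈ Finset.range S.card, f.coeff k * x i ^ k := by
      intro i
      rcases eq_or_ne f 0 with rfl | h0
      · simp
      · rw [degree_eq_natDegree h0] at hf
        exact eval_eq_sum_range' (by exact_mod_cast hf) _
    simp_rw [h2, Finset.mul_sum]
    rw [Finset.sum_comm]
    refine Finset.sum_eq_zero fun k hk => ?_
    rw [Finset.mem_range] at hk
    simp_rw [mul_left_comm (a _), ← Finset.mul_sum]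
    rw [h k hk, mul_zero]
  have h2 := h1 (Lagrange.basis S x j) (by
    rw [Lagrange.degree_basis hx hj]
    have := Finset.card_pos.2 ⟨j, hj⟩
    norm_cast
    omega)
  rw [Finset.sum_eq_single j] at h2
  · rwa [Lagrange.eval_basis_self hx hj, mul_one] at h2
  · intro i hi hij
    rw [Lagrange.eval_basis_of_ne hij.symm hi, mul_zero]
  · exact fun h => absurd hj h

theorem exists_sum_mul_pow_eq (hx : Set.InjOn x S) (β : ℕ → ℝ) :
    ∃ a : ι → ℝ, (∀ i ∉ S, a i = 0) ∧ ∀ k < S.card, ∑ i ∈ S, a i * x i ^ k = β k := by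
  classical
  -- The functional with prescribed moments β; its values on the Lagrange basis are the coefficients
  -- sought, by interpolation of X^k.
  let φ : ℝ[X] →ₗ[ℝ] ℝ := Polynomial.lsum fun k => LinearMap.lsmul ℝ ℝ (β k)
  have hφ : ∀ k, φ (X ^ k) = β k := by
    intro k
    simp [φ, Polynomial.lsum_apply, ← Polynomial.monomial_one_right_eq_X_pow]
  refine ⟨fun i => if i ∈ S then φ (Lagrange.basis S x i) else 0, fun i hi => if_neg hi, ?_⟩
  intro k hk
  have h1 := Lagrange.eq_interpolate (f := X ^ k) hx (by
    rw [degree_X_pow]; exact_mod_cast hk)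
  rw [← hφ k, h1, Lagrange.interpolate_apply, map_sum]
  refine Finset.sum_congr rfl fun i hi => ?_
  beta_reduce
  rw [if_pos hi, ← Polynomial.smul_eq_C_mul, map_smul, smul_eq_mul, mul_comm]
  simp

end Vandermonde

/-! ### The systems in coordinates -/

section Systems

/-- The vectors orthogonal to `v`. -/
def perp {s : ℕ} (v : Fin s → ℝ) : Submodule ℝ (Fin s → ℝ) where
  carrier := {w | w ⬝ᵥ v = 0}
  add_mem' := fun {x y} hx hy => by
    simp only [Set.mem_ofPred_eq] at *
    rw [add_dotProduct, hx, hy, add_zero]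
  zero_mem' := zero_dotProduct v
  smul_mem' := fun r x hx => by
    simp only [Set.mem_ofPred_eq] at *
    rw [smul_dotProduct, hx, smul_zero]

theorem mem_perp {s : ℕ} {v w : Fin s → ℝ} : w ∈ perp v ↔ w ⬝ᵥ v = 0 := Iff.rfl

theorem stdVec_stg {s : ℕ} (i : Fin s) : stdVec s (stg i) = Pi.single i 1 := by
  ext j
  simp [stdVec, Pi.single_apply, stg_injective.eq_iff]

theorem stdVec_dotProduct {s a : ℕ} {i : Fin s} (h : stg i = a) (v : Fin s → ℝ) :
    stdVec s a ⬝ᵥ v = v i := by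
  rw [← h, stdVec_stg, single_one_dotProduct]

theorem qVec_apply {s : ℕ} (A : Matrix (Fin s) (Fin s) ℝ) (c : Fin s → ℝ) (k : ℕ) (i : Fin s) :
    qVec A c k i = (A *ᵥ c ^ k) i - 1 / ((k : ℝ) + 1) * c i ^ (k + 1) := rfl

theorem dVec_apply {s : ℕ} (A : Matrix (Fin s) (Fin s) ℝ) (b c : Fin s → ℝ) (k : ℕ) (j : Fin s) :
    dVec A b c k j =
      ∑ i, b i * c i ^ k * A i j - 1 / ((k : ℝ) + 1) * (b j * (1 - c j ^ (k + 1))) := rfl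

variable {p : ℕ}

theorem mem_QTest_iff {k : ℕ} (hk : 1 ≤ k) {v : Fin (stages p) → ℝ} :
    v ∈ QTest p k ↔ ∀ i, lev i < k → v i = 0 := by
  constructor
  · intro h i hi
    rw [← stdVec_dotProduct (rfl : stg i = stg i) v]
    apply h
    rcases Nat.eq_zero_or_pos (lev i) with h0 | h0
    · rw [lev_eq_zero_iff.1 h0]
      exact Submodule.mem_sup_right (Submodule.mem_span_singleton_self _)
    · have h1 := (le_lev_iff (i := i) le_rfl).1 h0
      have h2 := (le_lev_iff (i := i) hk).not.1 (by omega)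
      rw [tri_one] at h1
      exact Submodule.mem_sup_left (Submodule.subset_span ⟨stg i, h1, by
        rw [mul_pred_div_two]; omega, rfl⟩)
  · intro h w hw
    suffices hle : WQ p k ⊔ Submodule.span ℝ {stdVec (stages p) 1} ≤ perp v from hle hw
    refine sup_le (Submodule.span_le.2 ?_) (Submodule.span_le.2 ?_)
    · rintro _ ⟨a, h1, h2, rfl⟩
      rw [SetLike.mem_coe, mem_perp]
      by_cases ha : a ≤ stages p
      · have h3 := stg_stageAt (p := p) (x := a) (by omega) ha
        rw [stdVec_dotProduct h3]
        apply h
        by_contra h4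
        rw [not_lt, le_lev_iff hk, h3] at h4
        rw [mul_pred_div_two] at h2
        omega
      · refine Finset.sum_eq_zero fun i _ => ?_
        have := stg_le i
        rw [stdVec, if_neg (by omega), zero_mul]
    · rintro _ rfl
      have h3 := stg_stageAt (p := p) (x := 1) le_rfl (by rw [stages_eq]; omega)
      rw [SetLike.mem_coe, mem_perp, stdVec_dotProduct h3]
      apply h
      rw [lev_eq_zero_iff.2 h3]
      exact hk

theorem one_le_rk {i : Fin (stages p)} (hi : Outer i) (h : 1 ≤ colev i) : 1 ≤ rk i := by
  have := rk_eq_zero_iff hi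
  omega

theorem sub_single_vecMul {A : Matrix (Fin (stages p)) (Fin (stages p)) ℝ} (i g : Fin (stages p)) :
    (Pi.single i 1 - Pi.single g 1 : Fin (stages p) → ℝ) ᵥ* A = A i - A g := by
  rw [sub_vecMul, single_one_vecMul, single_one_vecMul]
  rfl

theorem forall_QTest_iff {k : ℕ} (hk : 1 ≤ k) {y : Fin (stages p) → ℝ} :
    (∀ v ∈ QTest p k, y ⬝ᵥ v = 0) ↔ ∀ i, k ≤ lev i → y i = 0 := by
  constructor
  · intro h i hi
    rw [← dotProduct_single_one y i]
    apply h
    rw [mem_QTest_iff hk]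
    intro j hj
    rw [Pi.single_apply, if_neg]
    rintro rfl
    omega
  · intro h v hv
    rw [mem_QTest_iff hk] at hv
    refine Finset.sum_eq_zero fun i _ => ?_
    by_cases hi : lev i < k
    · rw [hv i hi, mul_zero]
    · rw [h i (by omega), zero_mul]

variable [hp : Fact (4 ≤ p)]

theorem ghost_outer {r : ℕ} (h1 : 1 ≤ r) (h2 : r ≤ mOf p) : Outer (ghost p r) :=
  (ghostPos_spec h1 h2).2.1

theorem colev_ghost {r : ℕ} (h1 : 1 ≤ r) (h2 : r ≤ mOf p) : colev (ghost p r) = nOf p :=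
  (ghostPos_spec h1 h2).2.2.1

theorem rk_ghost {r : ℕ} (h1 : 1 ≤ r) (h2 : r ≤ mOf p) : rk (ghost p r) = r :=
  (ghostPos_spec h1 h2).2.2.2

theorem epsVec_eq {i : Fin (stages p)} (h1 : 1 ≤ colev i) (h2 : colev i < nOf p) :
    epsVec p (colev i) (rk i) = Pi.single i 1 - Pi.single (ghost p (rk i)) 1 := by
  have hi := outer_of_colev_lt h2
  rw [epsVec, ← stg_eq_dPos h1 h2, stdVec_stg, ← stdVec_stg (ghost p (rk i)), ghost,
    (ghostPos_spec (one_le_rk hi h1) (rk_le hi)).1]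

theorem epsVec_mem_WD {i : Fin (stages p)} {k : ℕ} (h1 : 1 ≤ colev i) (h2 : colev i < nOf p)
    (h3 : colev i < k) :
    (Pi.single i 1 - Pi.single (ghost p (rk i)) 1 : Fin (stages p) → ℝ) ∈ WD p k :=
  Submodule.subset_span ⟨colev i, rk i, one_le_rk (outer_of_colev_lt h2) h1, rk_le_colev h2,
    by omega, (epsVec_eq h1 h2).symm⟩

theorem WD_le_iff {k : ℕ} (hk : k ≤ nOf p) (P : Submodule ℝ (Fin (stages p) → ℝ)) :
    WD p k ≤ P ↔ ∀ i, 1 ≤ colev i → colev i < k →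
      (Pi.single i 1 - Pi.single (ghost p (rk i)) 1 : Fin (stages p) → ℝ) ∈ P := by
  constructor
  · intro h i h1 h2
    exact h (epsVec_mem_WD h1 (by omega) h2)
  · intro h
    refine Submodule.span_le.2 ?_
    rintro _ ⟨j, r, h1, h2, h3, rfl⟩
    have hn := nOf_eq (p := p)
    obtain ⟨-, -, e3, e4⟩ := dPos_spec (p := p) h1 h2 (by omega)
    have h5 := h (stageAt p (dPos p j r)) (by omega) (by omega)
    rw [← epsVec_eq (by omega) (by omega), e3, e4] at h5
    exact h5

theorem mem_DTest_iff {k : ℕ} (hk : k ≤ nOf p) {v : Fin (stages p) → ℝ} :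
    v ∈ DTest p k ↔ (∀ i, ¬ Outer i → v i = 0) ∧ (∀ i, colev i = 0 → v i = 0) ∧
      ∀ i, 1 ≤ colev i → colev i < k → v i = v (ghost p (rk i)) := by
  have e1 : v ∈ VZero (stages p) (lOf p) ↔ ∀ i, ¬ Outer i → v i = 0 := by
    refine forall_congr' fun i => ?_
    rw [Outer, not_le, Nat.lt_succ_iff]
  have e2 : (∀ w ∈ WD p k ⊔ Submodule.span ℝ {stdVec (stages p) (stages p)}, w ⬝ᵥ v = 0) ↔
      WD p k ⊔ Submodule.span ℝ {stdVec (stages p) (stages p)} ≤ perp v := Iff.rfl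
  have hs : stg (stageAt p (stages p)) = stages p :=
    stg_stageAt (by rw [stages_eq]; omega) le_rfl
  rw [DTest, Set.mem_ofPred_eq, e1, e2, sup_le_iff, WD_le_iff hk, Submodule.span_le,
    Set.singleton_subset_iff, SetLike.mem_coe, mem_perp, stdVec_dotProduct hs, and_comm]
  refine and_congr_right fun _ => ?_
  rw [and_comm]
  refine and_congr ⟨?_, ?_⟩ ?_
  · intro h i hi
    rw [← h]
    exact congrArg v (stg_injective ((colev_eq_zero_iff.1 hi).trans hs.symm))
  · intro h
    exact h _ (colev_eq_zero_iff.2 hs)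
  · refine forall_congr' fun i => forall_congr' fun _ => forall_congr' fun _ => ?_
    rw [mem_perp, sub_dotProduct, single_one_dotProduct, single_one_dotProduct, sub_eq_zero]

theorem sum_outer (f : Fin (stages p) → ℝ) :
    ∑ i with Outer i, f i = ∑ r ∈ Finset.range (mOf p + 1), ∑ i ∈ Cl p r, f i := by
  rw [← Finset.sum_fiberwise_of_maps_to (t := Finset.range (mOf p + 1)) (g := rk)]
  · refine Finset.sum_congr rfl fun r _ => Finset.sum_congr ?_ fun _ _ => rfl
    ext i
    simp [mem_Cl]
  · intro i hi
    rw [Finset.mem_filter] at hi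
    rw [Finset.mem_range]
    have := rk_le hi.2
    omega

theorem Cl_zero {i : Fin (stages p)} : i ∈ Cl p 0 ↔ colev i = 0 := by
  rw [mem_Cl]
  constructor
  · rintro ⟨h1, h2⟩
    rwa [rk_eq_zero_iff h1] at h2
  · intro h
    have h1 : Outer i := outer_of_colev_lt (by rw [h, nOf_eq]; omega)
    exact ⟨h1, (rk_eq_zero_iff h1).2 h⟩

/-- A vector vanishing at the last stage and with vanishing cluster sums is orthogonal to
everything constant on clusters. -/
theorem sum_outer_mul_eq_zero {y : Fin (stages p) → ℝ} (h0 : ∀ i, colev i = 0 → y i = 0)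
    (h : ∀ r, 1 ≤ r → r ≤ mOf p → ∑ i ∈ Cl p r, y i = 0) (u : ℕ → ℝ) :
    ∑ i with Outer i, y i * u (rk i) = 0 := by
  rw [sum_outer]
  refine Finset.sum_eq_zero fun r hr => ?_
  rw [Finset.mem_range] at hr
  rcases Nat.eq_zero_or_pos r with rfl | h1
  · refine Finset.sum_eq_zero fun i hi => ?_
    rw [h0 i (Cl_zero.1 hi), zero_mul]
  · rw [Finset.sum_congr rfl (g := fun i => y i * u r) fun i hi => by rw [(mem_Cl.1 hi).2],
      ← Finset.sum_mul, h r h1 (by omega), zero_mul]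

/-- A test vector is free at the D-group stages of colevel at least k and at the ghosts, each ghost
value being copied to the D-group stages of smaller colevel in its cluster, except for the last
stage. Unit vectors and cluster indicators detect the two conditions. -/
theorem forall_DTest_iff {k : ℕ} (hk : k ≤ nOf p) {y : Fin (stages p) → ℝ} :
    (∀ v ∈ DTest p k, y ⬝ᵥ v = 0) ↔
      (∀ i, 1 ≤ colev i → k ≤ colev i → colev i < nOf p → y i = 0) ∧
        ∀ r, 1 ≤ r → r ≤ mOf p → ∑ i ∈ Cl p r, y i = 0 := by
  have hn := nOf_eq (p := p)
  constructor
  · refine fun h => ⟨fun i h1 h2 h3 => ?_, fun r h1 h2 => ?_⟩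
    · rw [← dotProduct_single_one y i]
      apply h
      rw [mem_DTest_iff hk]
      have ho := outer_of_colev_lt h3
      refine ⟨fun j hj => ?_, fun j hj => ?_, fun j hj1 hj2 => ?_⟩
      · rw [Pi.single_apply, if_neg]
        rintro rfl
        exact hj ho
      · rw [Pi.single_apply, if_neg]
        rintro rfl
        omega
      · have hoj : Outer j := outer_of_colev_lt (by omega)
        have hg := colev_ghost (one_le_rk hoj hj1) (rk_le hoj)
        rw [Pi.single_apply, if_neg, Pi.single_apply, if_neg]
        · intro h; rw [h] at hg; omega
        · rintro rfl; omega
    · have h3 := h (fun i => if i ∈ Cl p r then 1 else 0) ?_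
      · simpa [dotProduct, Finset.sum_ite_mem] using h3
      · rw [mem_DTest_iff hk]
        refine ⟨fun j hj => ?_, fun j hj => ?_, fun j hj1 hj2 => ?_⟩
        · exact if_neg fun h => hj (mem_Cl.1 h).1
        · have h4 := mem_Cl.1 (Cl_zero.2 hj)
          refine if_neg fun h => ?_
          have := (mem_Cl.1 h).2
          omega
        · have hoj : Outer j := outer_of_colev_lt (by omega)
          have hg := rk_ghost (one_le_rk hoj hj1) (rk_le hoj)
          have hg' := ghost_outer (one_le_rk hoj hj1) (rk_le hoj)
          simp only [mem_Cl, hg, hg', hoj, true_and]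
  · rintro ⟨h1, h2⟩ v hv
    rw [mem_DTest_iff hk] at hv
    obtain ⟨v1, v2, v3⟩ := hv
    -- The entry of y at the last stage is unconstrained, but v vanishes there, so it may be set to
    -- zero.
    have h3 := sum_outer_mul_eq_zero (p := p) (y := fun i => if colev i = 0 then 0 else y i)
      (fun i hi => if_pos hi) (fun r hr1 hr2 => by
        rw [← h2 r hr1 hr2]
        refine Finset.sum_congr rfl fun i hi => if_neg fun h => ?_
        have := (mem_Cl.1 hi).2
        rw [(mem_Cl.1 (Cl_zero.2 h)).2] at this
        omega) (fun r => v (ghost p r))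
    rw [Finset.sum_filter] at h3
    rw [← h3]
    refine Finset.sum_congr rfl fun i _ => ?_
    by_cases ho : Outer i
    · rw [if_pos ho]
      by_cases h0 : colev i = 0
      · rw [if_pos h0, v2 i h0, mul_zero, zero_mul]
      · rw [if_neg h0]
        have := colev_le ho
        rcases this.eq_or_lt with h | h
        · exact congrArg (fun j => y i * v j) (eq_ghost ho h)
        · by_cases h' : colev i < k
          · rw [v3 i (by omega) h']
          · rw [h1 i (by omega) (by omega) h, zero_mul, zero_mul]
    · rw [if_neg ho, v1 i ho, mul_zero]

/-- The defining systems of the construction in coordinates. -/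
structure Solves (p : ℕ) (A : Matrix (Fin (stages p)) (Fin (stages p)) ℝ)
    (b c : Fin (stages p) → ℝ) : Prop where
  support : ∀ i j, ¬ (Outer j ∧ colev i < nOf p ∧ colev i < colev j) →
    ¬ (lev j < mOf p ∧ lev j < lev i) → A i j = 0
  q : ∀ i k, k < lev i → k < mOf p → (A *ᵥ c ^ k) i = 1 / ((k : ℝ) + 1) * c i ^ (k + 1)
  q_zero : ∀ i j, 1 ≤ lev j → lev j + 2 ≤ lev i → lev j + 2 ≤ mOf p → A i j = 0
  d : ∀ k < nOf p, ∀ j, k + 1 ≤ colev j → colev j < nOf p → dVec A b c k j = 0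
  d_cluster : ∀ k < nOf p, ∀ r, 1 ≤ r → r ≤ mOf p → ∑ j ∈ Cl p r, dVec A b c k j = 0
  row_zero : ∀ i j, 1 ≤ colev i → colev i + 2 ≤ colev j → colev j < nOf p → A i j = 0
  row_cluster : ∀ i, 1 ≤ colev i → colev i + 2 ≤ nOf p → ∀ r, 1 ≤ r → r ≤ mOf p →
    ∑ j ∈ Cl p r, A i j = 0

variable {A : Matrix (Fin (stages p)) (Fin (stages p)) ℝ} {b c : Fin (stages p) → ℝ}

theorem support_iff : (∀ i j, (stg i, stg j) ∉ ID p ∪ IQ p → A i j = 0) ↔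
    ∀ i j, ¬ (Outer j ∧ colev i < nOf p ∧ colev i < colev j) →
      ¬ (lev j < mOf p ∧ lev j < lev i) → A i j = 0 := by
  simp only [Set.mem_union, mem_ID_iff, mem_IQ_iff, not_or, and_imp]

theorem ghost_row_eq_zero
    (hs : ∀ i j, ¬ (Outer j ∧ colev i < nOf p ∧ colev i < colev j) →
      ¬ (lev j < mOf p ∧ lev j < lev i) → A i j = 0)
    {i j : Fin (stages p)} (hi : nOf p ≤ colev i) (hj : Outer j) : A i j = 0 := by
  apply hs
  · omega
  · rw [outer_iff] at hj
    omega

/-- Multiplying a generator of W^D by A gives a D-group row minus a ghost row, and ghost rows vanish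
on outer columns. Hence the tests on such products concern single rows. -/
theorem isConstructed_iff : IsConstructed p A b c ↔ Solves p A b c := by
  have hn := nOf_eq (p := p)
  constructor
  · rintro ⟨h1, ⟨h2, h3⟩, ⟨h4, h5⟩⟩
    rw [support_iff] at h1
    -- The test spaces shrink as k grows, so the smallest k whose W_(k-1)^D contains the generator
    -- of stage i gives the strongest condition.
    have hD : ∀ i, 1 ≤ colev i → ∀ k, colev i + 2 = k → k ≤ nOf p →
        (∀ j, 1 ≤ colev j → k ≤ colev j → colev j < nOf p → A i j = 0) ∧
        ∀ r, 1 ≤ r → r ≤ mOf p → ∑ j ∈ Cl p r, A i j = 0 := by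
      intro i hi k hik hk
      have ho : Outer i := outer_of_colev_lt (by omega)
      have hg := colev_ghost (one_le_rk ho hi) (rk_le ho)
      have h6 := (forall_DTest_iff hk).1 (h3 k (by omega) hk _
        (epsVec_mem_WD (k := k - 1) hi (by omega) (by omega)))
      rw [sub_single_vecMul] at h6
      have h7 : ∀ j, Outer j → (A i - A (ghost p (rk i))) j = A i j := by
        intro j hj
        rw [Pi.sub_apply, ghost_row_eq_zero h1 hg.ge hj, sub_zero]
      refine ⟨fun j hj1 hj2 hj3 => ?_, fun r hr1 hr2 => ?_⟩
      · rw [← h7 j (outer_of_colev_lt hj3)]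
        exact h6.1 j hj1 hj2 hj3
      · rw [← h6.2 r hr1 hr2]
        exact Finset.sum_congr rfl fun j hj => (h7 j (mem_Cl.1 hj).1).symm
    refine ⟨h1, ?_, ?_, ?_, ?_, ?_, ?_⟩
    · intro i k hk hm
      have h6 := (forall_QTest_iff (by omega)).1 (h4 (k + 1) (by omega) (by omega)) i hk
      rw [Nat.add_sub_cancel, qVec_apply] at h6
      linarith
    · intro i j hj hij hjm
      have h6 := (forall_QTest_iff (by omega)).1 (h5 (lev j + 2) (by omega) (by omega)
        (Pi.single j 1) ?_) i hij
      · rwa [mulVec_single_one] at h6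
      · have e1 := (lev_eq_iff (i := j) hj).1 rfl
        refine Submodule.subset_span ⟨stg j, by omega, ?_, (stdVec_stg j).symm⟩
        rw [mul_pred_div_two]
        exact e1.2
    · intro k hk j hj hjn
      exact ((forall_DTest_iff (by omega)).1 (h2 (k + 1) (by omega) (by omega))).1 j
        (by omega) hj hjn
    · intro k hk r hr1 hr2
      exact ((forall_DTest_iff (by omega)).1 (h2 (k + 1) (by omega) (by omega))).2 r hr1 hr2
    · intro i j hi hij hj
      exact (hD i hi _ rfl (by omega)).1 j (by omega) hij hj
    · intro i hi hin
      exact (hD i hi _ rfl hin).2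
  · rintro ⟨h1, h2, h3, h4, h5, h6, h7⟩
    refine ⟨support_iff.2 h1, ⟨?_, ?_⟩, ⟨?_, ?_⟩⟩
    · intro k hk1 hk2
      rw [forall_DTest_iff hk2]
      exact ⟨fun i h1 hi hin => h4 _ (by omega) i (by omega) hin, h5 _ (by omega)⟩
    · intro k hk1 hk2 u hu v hv
      rw [← dotProduct_mulVec]
      suffices hle : WD p (k - 1) ≤ perp (A *ᵥ v) from hle hu
      rw [WD_le_iff (by omega)]
      intro i hi1 hi2
      rw [mem_perp, dotProduct_mulVec, sub_single_vecMul]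
      revert v hv
      rw [forall_DTest_iff hk2]
      have ho : Outer i := outer_of_colev_lt (by omega)
      have hg := colev_ghost (one_le_rk ho hi1) (rk_le ho)
      have h8 : ∀ j, Outer j → (A i - A (ghost p (rk i))) j = A i j := by
        intro j hj
        rw [Pi.sub_apply, ghost_row_eq_zero h1 hg.ge hj, sub_zero]
      refine ⟨fun j hj1 hj2 hj3 => ?_, fun r hr1 hr2 => ?_⟩
      · rw [h8 j (outer_of_colev_lt hj3)]
        exact h6 i j hi1 (by omega) hj3
      · rw [← h7 i hi1 (by omega) r hr1 hr2]
        exact Finset.sum_congr rfl fun j hj => h8 j (mem_Cl.1 hj).1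
    · intro k hk1 hk2
      rw [forall_QTest_iff hk1]
      intro i hi
      rw [qVec_apply, h2 i (k - 1) (by omega) (by omega), sub_self]
    · intro k hk1 hk2 u hu v hv
      rw [dotProduct_comm, dotProduct_mulVec, dotProduct_comm]
      suffices hle : WQ p (k - 1) ≤ perp (v ᵥ* A) from hle hu
      refine Submodule.span_le.2 ?_
      rintro _ ⟨a, ha1, ha2, rfl⟩
      rw [SetLike.mem_coe, mem_perp]
      by_cases ha : a ≤ stages p
      · have h8 := stg_stageAt (p := p) (x := a) (by omega) ha
        rw [stdVec_dotProduct h8]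
        rw [mem_QTest_iff (by omega)] at hv
        change ∑ i, v i * A i (stageAt p a) = 0
        refine Finset.sum_eq_zero fun i _ => ?_
        by_cases hi : lev i < k
        · rw [hv i hi, zero_mul]
        · have e1 := (le_lev_iff (i := stageAt p a) le_rfl).2 (by rw [h8, tri_one]; omega)
          have e2 : ¬ k - 1 ≤ lev (stageAt p a) := by
            rw [mul_pred_div_two] at ha2
            rw [le_lev_iff (by omega), h8]
            omega
          rw [h3 i _ e1 (by omega) (by omega), mul_zero]
      · refine Finset.sum_eq_zero fun i _ => ?_
        have := stg_le i
        rw [stdVec, if_neg (by omega), zero_mul]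

end Systems

/-! ### Properties of the constructed methods -/

section Properties

variable {p : ℕ}

theorem lev_mono {i j : Fin (stages p)} (h : i ≤ j) : lev i ≤ lev j :=
  block_mono (Nat.sub_le_sub_right (Nat.succ_le_succ h) 1)

theorem colev_anti {i j : Fin (stages p)} (h : i ≤ j) : colev j ≤ colev i :=
  block_mono (Nat.sub_le_sub_left (Nat.succ_le_succ h) _)

/-- The vectors supported on the levels `1, …, k-1`. -/
def levelSpace (p k : ℕ) : Submodule ℝ (Fin (stages p) → ℝ) where
  carrier := {v | ∀ i, ¬ (1 ≤ lev i ∧ lev i < k) → v i = 0}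
  add_mem' := fun {x y} hx hy i hi => by rw [Pi.add_apply, hx i hi, hy i hi, add_zero]
  zero_mem' := fun _ _ => rfl
  smul_mem' := fun r x hx i hi => by rw [Pi.smul_apply, hx i hi, smul_zero]

/-- A functional separating v from P is a dot product with its values on the standard basis. This
lets spanning statements be proved by duality. -/
theorem mem_of_forall_dotProduct {s : ℕ} (P : Submodule ℝ (Fin s → ℝ)) (v : Fin s → ℝ)
    (h : ∀ z : Fin s → ℝ, (∀ q ∈ P, z ⬝ᵥ q = 0) → z ⬝ᵥ v = 0) : v ∈ P := by
  by_contra hv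
  obtain ⟨f, hf, hP⟩ := Submodule.exists_le_ker_of_notMem hv
  have h1 : ∀ x, f x = (fun i => f (Pi.single i 1)) ⬝ᵥ x := by
    intro x
    conv_lhs => rw [pi_eq_sum_univ' x, map_sum]
    refine Finset.sum_congr rfl fun i _ => ?_
    rw [map_smul, smul_eq_mul, mul_comm]
  rw [h1] at hf
  refine hf (h _ fun q hq => ?_)
  rw [← h1]
  exact hP hq

theorem finrank_levelSpace [Fact (4 ≤ p)] :
    Module.finrank ℝ (levelSpace p (mOf p)) = lOf p := by
  let S : Finset (Fin (stages p)) := Finset.univ.filter fun i => 1 ≤ lev i ∧ lev i < mOf p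
  let e : levelSpace p (mOf p) ≃ₗ[ℝ] (S → ℝ) :=
    { toFun := fun v i => v.1 i
      map_add' := fun _ _ => rfl
      map_smul' := fun _ _ => rfl
      invFun := fun f => ⟨fun i => if h : i ∈ S then f ⟨i, h⟩ else 0, fun i hi =>
        dif_neg fun h => hi (by simpa [S] using h)⟩
      left_inv := fun v => by
        ext i
        by_cases h : i ∈ S
        · simp [h]
        · simp only [h, dite_false]
          exact (v.2 i fun h' => h (Finset.mem_filter.2 ⟨Finset.mem_univ i, h'⟩)).symm
      right_inv := fun f => by
        ext i
        simp }
  rw [e.finrank_eq, Module.finrank_fintype_fun_eq_card, Fintype.card_coe]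
  have e2 := stages_eq (p := p)
  have h := card_filter_stg (s := stages p) (a := 2) (b := lOf p + 1) (by omega) (by omega)
  rw [show lOf p + 1 + 1 - 2 = lOf p by omega] at h
  rw [← h]
  refine congrArg Finset.card (Finset.filter_congr fun i _ => ?_)
  have e3 := le_lev_iff (i := i) le_rfl
  have e4 := le_lev_iff (i := i) (one_le_mOf (p := p))
  rw [tri_one] at e3
  rw [lOf_eq]
  omega

/-- Membership in `W_k^D` in coordinates. -/
theorem mem_WD [Fact (4 ≤ p)] {k : ℕ} (hk : k ≤ nOf p) {y : Fin (stages p) → ℝ}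
    (h1 : ∀ i, ¬ Outer i → y i = 0) (h2 : ∀ i, colev i = 0 → y i = 0)
    (h3 : ∀ i, 1 ≤ colev i → k ≤ colev i → colev i < nOf p → y i = 0)
    (h4 : ∀ r, 1 ≤ r → r ≤ mOf p → ∑ i ∈ Cl p r, y i = 0) : y ∈ WD p k := by
  refine mem_of_forall_dotProduct _ _ fun z hz => ?_
  -- Cutting z off at the inner stages and at the last stage makes it a test vector and does not
  -- change its product with y.
  have h5 := (forall_DTest_iff hk).2 ⟨h3, h4⟩
    (fun i => if Outer i ∧ colev i ≠ 0 then z i else 0) ?_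
  · rw [← h5, dotProduct_comm]
    refine Finset.sum_congr rfl fun i _ => ?_
    beta_reduce
    split_ifs with h
    · rfl
    · rw [mul_zero]
      by_cases ho : Outer i
      · rw [h2 i (by tauto), zero_mul]
      · rw [h1 i ho, zero_mul]
  · rw [mem_DTest_iff hk]
    refine ⟨fun i hi => if_neg fun h => hi h.1, fun i hi => if_neg fun h => h.2 hi, ?_⟩
    intro i hi1 hi2
    have ho : Outer i := outer_of_colev_lt (by omega)
    have hr := one_le_rk ho hi1
    have hg := colev_ghost hr (rk_le ho)
    rw [if_pos ⟨ho, by omega⟩, if_pos ⟨ghost_outer hr (rk_le ho), by omega⟩]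
    have h6 := hz _ (epsVec_mem_WD (k := k) hi1 (by omega) hi2)
    rw [dotProduct_sub, dotProduct_single_one, dotProduct_single_one, sub_eq_zero] at h6
    exact h6

variable {A : Matrix (Fin (stages p)) (Fin (stages p)) ℝ} {b c : Fin (stages p) → ℝ}

theorem Solves.strictly_lower (hS : Solves p A b c) {i j : Fin (stages p)} (h : i ≤ j) :
    A i j = 0 := by
  have h1 := lev_mono h
  have h2 := colev_anti h
  exact hS.support i j (by omega) (by omega)

theorem Solves.first_row (hS : Solves p A b c) {i : Fin (stages p)} (h : lev i = 0)
    (j : Fin (stages p)) : A i j = 0 := by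
  refine hS.strictly_lower (Nat.le_of_succ_le_succ ?_)
  have h1 := lev_eq_zero_iff.1 h
  have h2 := one_le_stg j
  change stg i ≤ stg j
  omega

theorem Solves.mulVec_first (hS : Solves p A b c) {i : Fin (stages p)} (h : lev i = 0)
    (u : Fin (stages p) → ℝ) : (A *ᵥ u) i = 0 := by
  change ∑ j, A i j * u j = 0
  exact Finset.sum_eq_zero fun j _ => by rw [hS.first_row h, zero_mul]

theorem Solves.mulVec_mem_levelSpace (hS : Solves p A b c) {k : ℕ} (hk : k + 1 ≤ mOf p)
    {u : Fin (stages p) → ℝ} (hu : u ∈ levelSpace p k) : A *ᵥ u ∈ levelSpace p (k + 1) := by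
  intro i hi
  change ∑ j, A i j * u j = 0
  refine Finset.sum_eq_zero fun j _ => ?_
  by_cases hj : 1 ≤ lev j ∧ lev j < k
  · by_cases h0 : lev i = 0
    · rw [hS.first_row h0, zero_mul]
    · rw [hS.q_zero i j hj.1 (by omega) (by omega), zero_mul]
  · rw [hu j hj, mul_zero]

variable [hp : Fact (4 ≤ p)]

/-! ### Explicitness and the Q-spaces. -/

theorem Solves.isExplicitTableau (hS : Solves p A b c) (hc : IsStageVector p c) :
    IsExplicitTableau A c := by
  refine ⟨fun i j h => hS.strictly_lower h, fun i => ?_⟩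
  rcases Nat.eq_zero_or_pos (lev i) with h | h
  · rw [hc.first_eq_zero h]
    exact (Finset.sum_eq_zero fun j _ => hS.first_row h j).symm
  · have h1 := hS.q i 0 h one_le_mOf
    simp only [mulVec, dotProduct, Pi.pow_apply, pow_zero, mul_one] at h1
    rw [h1]
    simp

theorem Solves.qVec_eq_zero (hS : Solves p A b c) (hc : IsStageVector p c) {k : ℕ}
    (hk : k < mOf p) {i : Fin (stages p)} (hi : lev i = 0 ∨ k < lev i) : qVec A c k i = 0 := by
  rw [qVec_apply]
  rcases hi with h | h
  · rw [hS.mulVec_first h, hc.first_eq_zero h, zero_pow (by omega), mul_zero, sub_zero]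
  · rw [hS.q i k h hk, sub_self]

theorem Solves.QSpace_le (hS : Solves p A b c) (hc : IsStageVector p c) {k : ℕ}
    (hk : k ≤ mOf p) : QSpace A c k ≤ levelSpace p k := by
  induction k with
  | zero => exact bot_le
  | succ k ih =>
    have ih := ih (by omega)
    refine Submodule.span_le.2 ?_
    rintro _ ((rfl | ⟨u, hu, rfl⟩) | ⟨u, hu, f, -, rfl⟩)
    · intro i hi
      exact hS.qVec_eq_zero hc hk (by omega)
    · exact hS.mulVec_mem_levelSpace hk (ih hu)
    · intro i hi
      beta_reduce
      rw [Pi.mul_apply, ih hu i (by omega), zero_mul]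

theorem IsStageVector.injOn_lev (hc : IsStageVector p c) {g : ℕ} (h1 : g < mOf p) :
    Set.InjOn c (Finset.univ.filter fun i : Fin (stages p) => lev i = g) := by
  refine (hc.injOn_QNodes (g := g + 1) (by omega)).mono fun i hi => ?_
  simp only [Finset.coe_filter, Finset.mem_univ, true_and, Set.mem_ofPred_eq] at hi
  simp only [QNodes, Finset.coe_filter, Finset.mem_univ, true_and, Set.mem_ofPred_eq]
  omega

/-- By duality, a vector z orthogonal to Q_(k+1) must vanish on levels 1,…,k. Lower levels are
covered by induction; on level k, q_k and the vectors A u with u ∈ Q_k yield k moment equations at k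
distinct nonzero nodes. -/
theorem Solves.le_QSpace (hS : Solves p A b c) (hc : IsStageVector p c) {k : ℕ}
    (hk : k ≤ mOf p) : levelSpace p k ≤ QSpace A c k := by
  induction k with
  | zero =>
    intro v hv
    have : v = 0 := by
      ext i
      exact hv i (by omega)
    rw [this]
    exact zero_mem _
  | succ k ih =>
    have ih := ih (by omega)
    intro v hv
    refine mem_of_forall_dotProduct _ _ fun z hz => ?_
    have hlow : ∀ i, 1 ≤ lev i → lev i < k → z i = 0 := by
      intro i h1 h2
      rw [← dotProduct_single_one z i]
      refine hz _ (QSpace_le_succ k (ih fun j hj => ?_))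
      rw [Pi.single_apply, if_neg]
      rintro rfl
      exact hj ⟨h1, h2⟩
    suffices hk0 : ∀ i, 1 ≤ lev i → lev i = k → z i = 0 by
      refine Finset.sum_eq_zero fun i _ => ?_
      by_cases hi : 1 ≤ lev i ∧ lev i < k + 1
      · by_cases h : lev i < k
        · rw [hlow i hi.1 h, zero_mul]
        · rw [hk0 i hi.1 (by omega), zero_mul]
      · rw [hv i hi, mul_zero]
    rcases Nat.eq_zero_or_pos k with rfl | hkpos
    · intro i h1 h2
      omega
    set G := Finset.univ.filter fun i : Fin (stages p) => lev i = k with hG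
    have hmem : ∀ i, i ∈ G ↔ lev i = k := fun i => by simp [hG]
    have hsum : ∀ f ∈ QSpace A c (k + 1), ∑ i ∈ G, z i * f i = 0 := by
      intro f hf
      rw [← hz f hf, dotProduct]
      refine Finset.sum_subset (Finset.subset_univ _) fun i _ hi => ?_
      rw [hmem] at hi
      by_cases h : 1 ≤ lev i ∧ lev i < k + 1
      · rw [hlow i h.1 (by omega), zero_mul]
      · rw [hS.QSpace_le hc hk hf i h, mul_zero]
    have hA : ∀ e, 1 ≤ e → ∑ i ∈ G, z i * (A *ᵥ c ^ e) i = 0 := by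
      intro e he
      -- On rows of level k the truncated power has the same image under A as c^e: the first node is
      -- zero and e ≥ 1, and columns of level at least k do not contribute.
      set u : Fin (stages p) → ℝ := fun j => if 1 ≤ lev j ∧ lev j < k then c j ^ e else 0 with hu
      have h1 : u ∈ QSpace A c k := ih fun j hj => if_neg hj
      rw [← hsum _ (mulVec_mem_QSpace h1)]
      refine Finset.sum_congr rfl fun i hi => ?_
      rw [hmem] at hi
      congr 1
      change ∑ j, A i j * (c ^ e) j = ∑ j, A i j * u j
      refine Finset.sum_congr rfl fun j _ => ?_
      by_cases hj : 1 ≤ lev j ∧ lev j < k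
      · simp [hu, hj]
      · rcases Nat.eq_zero_or_pos (lev j) with h0 | h0
        · rw [Pi.pow_apply, hc.first_eq_zero h0, zero_pow (by omega), mul_zero, hu]
          simp [h0]
        · rw [hS.support i j, zero_mul, zero_mul]
          · rintro ⟨-, h3, -⟩
            have := outer_iff.1 (outer_of_colev_lt h3)
            omega
          · omega
    -- With the product A c^(e+1) already orthogonal to z on this level, the relation for q_(e+1)
    -- leaves the moment of order e+2. For e+1 < k this q-vector vanishes on the level, and for e+1
    -- = k it lies in Q_(k+1).
    have hpow : ∀ e < k, ∑ i ∈ G, (z i * c i ^ 2) * c i ^ e = 0 := by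
      intro e he
      have h1 : ∑ i ∈ G, z i * qVec A c (e + 1) i = 0 := by
        by_cases hek : e + 1 < k
        · refine Finset.sum_eq_zero fun i hi => ?_
          rw [hmem] at hi
          rw [hS.qVec_eq_zero hc (by omega) (by omega), mul_zero]
        · obtain rfl : e + 1 = k := by omega
          exact hsum _ (qVec_mem_QSpace _)
      simp only [qVec_apply, mul_sub, Finset.sum_sub_distrib] at h1
      rw [hA _ (by omega), zero_sub, neg_eq_zero] at h1
      simp_rw [mul_left_comm (z _), ← Finset.mul_sum] at h1
      rcases mul_eq_zero.1 h1 with h1 | h1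
      · have : (0 : ℝ) < 1 / (((e + 1 : ℕ) : ℝ) + 1) := by positivity
        exact absurd h1 this.ne'
      · rw [← h1]
        refine Finset.sum_congr rfl fun i _ => ?_
        rw [mul_assoc, ← pow_add]
        congr 2
        omega
    intro i h1 h2
    have h3 := eq_zero_of_sum_mul_pow_eq_zero G c (hc.injOn_lev (by omega))
      (fun i => z i * c i ^ 2) (by rwa [hG, card_filter_lev hkpos (by omega)]) i ((hmem i).2 h2)
    exact (mul_eq_zero.1 h3).resolve_right (pow_ne_zero 2 (hc.ne_zero h1 (by omega)))

theorem Solves.QSpace_eq (hS : Solves p A b c) (hc : IsStageVector p c) {k : ℕ}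
    (hk : k ≤ mOf p) : QSpace A c k = levelSpace p k :=
  le_antisymm (hS.QSpace_le hc hk) (hS.le_QSpace hc hk)

/-! ### The weights -/

theorem IsWeightVector.eq_zero (hb : IsWeightVector p c b) {i : Fin (stages p)} (h1 : 1 ≤ lev i)
    (h2 : lev i < mOf p) : b i = 0 := by
  have e1 := (le_lev_iff (i := i) le_rfl).1 h1
  have e2 := (le_lev_iff (i := i) (one_le_mOf (p := p))).not.1 (by omega)
  rw [tri_one] at e1
  exact hb.mem_V i e1 (by rw [lOf_eq]; omega)

theorem IsWeightVector.sum_Cl (hc : IsStageVector p c) (hb : IsWeightVector p c b) {r : ℕ}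
    (hr : r ≤ mOf p) : ∑ i ∈ Cl p r, b i = lobattoWeight (NOf p) (NOf p - r) := by
  rcases Nat.eq_zero_or_pos r with rfl | h
  · have hs : stg (stageAt p (stages p)) = stages p :=
      stg_stageAt (by rw [stages_eq]; omega) le_rfl
    rw [Finset.sum_eq_single (stageAt p (stages p)), hb.last _ hs, Nat.sub_zero]
    · intro i hi hne
      exact absurd (stg_injective ((colev_eq_zero_iff.1 (Cl_zero.1 hi)).trans hs.symm)) hne
    · intro h
      exact absurd (Cl_zero.2 (colev_eq_zero_iff.2 hs)) h
  · have hn := nOf_eq (p := p)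
    have hN := NOf_eq (p := p)
    rw [← hc.cluster_eq hr]
    exact hb.cluster_sum _ (by omega) (by omega)

/-- Clusters are numbered from the right end, cluster r belonging to x_(N-r), and the first node
lies outside them; the quadrature sum is reordered to match. -/
theorem sum_Icc_eq (m : ℕ) (f : ℕ → ℝ) :
    ∑ i ∈ Finset.Icc 1 (m + 2), f i = f 1 + ∑ r ∈ Finset.range (m + 1), f (m + 2 - r) := by
  have h1 : Finset.Icc 1 (m + 2) = Finset.Ico 1 (m + 3) := rfl
  rw [h1, Finset.sum_Ico_eq_sum_range, show m + 3 - 1 = m + 1 + 1 from rfl,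
    Finset.sum_range_succ', add_comm (∑ _ ∈ _, _), ← Finset.sum_range_reflect, add_zero]
  refine congrArg (f 1 + ·) (Finset.sum_congr rfl fun r hr => ?_)
  rw [Finset.mem_range] at hr
  exact congrArg f (by omega)

theorem IsWeightVector.dotProduct_pow (hc : IsStageVector p c) (hb : IsWeightVector p c b)
    {k : ℕ} (hk : k + 1 ≤ 2 * mOf p + 2) : b ⬝ᵥ c ^ k = 1 / ((k : ℝ) + 1) := by
  have hn := nOf_eq (p := p)
  have hN := NOf_eq (p := p)
  rw [← sum_lobattoWeight_mul_pow (three_le_NOf (p := p)) (k := k) (by omega), hN, hn,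
    sum_Icc_eq, dotProduct, ← Finset.sum_filter_add_sum_filter_not _ Outer, add_comm]
  congr 1
  · have h1 : stg (stageAt p 1) = 1 := stg_stageAt le_rfl (by rw [stages_eq]; omega)
    have hm := one_le_mOf (p := p)
    rw [Finset.sum_eq_single (stageAt p 1)]
    · rw [hb.first _ h1, Pi.pow_apply, hc.first _ h1, hN, hn]
    · intro i hi hne
      rw [Finset.mem_filter, outer_iff] at hi
      rw [hb.eq_zero _ (by omega), zero_mul]
      by_contra h
      exact hne (stg_injective ((lev_eq_zero_iff.1 (by omega)).trans h1.symm))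
    · intro h
      refine absurd (Finset.mem_filter.2 ⟨Finset.mem_univ _, ?_⟩) h
      rw [Outer, h1]
      omega
  · rw [sum_outer]
    refine Finset.sum_congr rfl fun r hr => ?_
    rw [Finset.mem_range] at hr
    have h2 := hb.sum_Cl hc (r := r) (by omega)
    rw [hN, hn] at h2
    rw [← h2, Finset.sum_mul]
    refine Finset.sum_congr rfl fun i hi => ?_
    rw [mem_Cl] at hi
    rw [Pi.pow_apply, hc.outer hi.1, hi.2, hN, hn]

/-! ### The `D`-spaces -/

/-- A row combination orthogonal to low powers of the nodes, also after restriction to the outer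
stages, vanishes off the outer stages. -/
theorem eq_zero_of_not_outer (hc : IsStageVector p c) {y : Fin (stages p) → ℝ}
    (h1 : ∀ j, 1 ≤ lev j → lev j + 2 ≤ mOf p → y j = 0)
    (h2 : ∀ q < mOf p, y ⬝ᵥ c ^ q = 0)
    (h3 : ∀ q < mOf p, ∑ j with Outer j, y j * c j ^ q = 0) :
    ∀ j, ¬ Outer j → y j = 0 := by
  have hm := one_le_mOf (p := p)
  have hmem : ∀ j, j ∈ QNodes p (mOf p) ↔ lev j = 0 ∨ lev j = mOf p - 1 := fun j => by
    simp [QNodes]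
  -- Only levels 0 and m-1 survive among the inner stages. They have m distinct nodes, and removing
  -- the outer part leaves m vanishing moments.
  have h4 := eq_zero_of_sum_mul_pow_eq_zero (QNodes p (mOf p)) c (hc.injOn_QNodes le_rfl) y (by
    rw [card_QNodes hm le_rfl]
    intro q hq
    have h5 := h2 q hq
    rw [dotProduct, ← Finset.sum_filter_add_sum_filter_not _ Outer] at h5
    simp only [Pi.pow_apply] at h5
    rw [h3 q hq, zero_add] at h5
    rw [← h5]
    refine Finset.sum_subset (fun j hj => ?_) fun j hj hj' => ?_
    · rw [hmem] at hj
      rw [Finset.mem_filter, outer_iff]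
      exact ⟨Finset.mem_univ j, by omega⟩
    · rw [hmem] at hj'
      rw [Finset.mem_filter, outer_iff] at hj
      rw [h1 j (by omega) (by omega), zero_mul])
  intro j hj
  rw [outer_iff] at hj
  by_cases h : lev j = 0 ∨ lev j = mOf p - 1
  · exact h4 j ((hmem j).2 h)
  · exact h1 j (by omega) (by omega)

theorem Solves.last_column (hS : Solves p A b c) (i : Fin (stages p)) {j : Fin (stages p)}
    (hj : colev j = 0) : A i j = 0 := by
  have h1 := outer_iff.1 (outer_of_colev_lt (i := j) (by rw [hj, nOf_eq]; omega))
  exact hS.support i j (by omega) (by omega)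

theorem sum_outer_mul_pow_eq_zero (hc : IsStageVector p c) {y : Fin (stages p) → ℝ}
    (h0 : ∀ i, colev i = 0 → y i = 0)
    (h : ∀ r, 1 ≤ r → r ≤ mOf p → ∑ i ∈ Cl p r, y i = 0) (q : ℕ) :
    ∑ j with Outer j, y j * c j ^ q = 0 := by
  rw [← sum_outer_mul_eq_zero h0 h fun r => lobattoNode (NOf p) (NOf p - r) ^ q]
  refine Finset.sum_congr rfl fun j hj => ?_
  rw [hc.outer (Finset.mem_filter.1 hj).2]

theorem IsStageVector.ghost_eq (hc : IsStageVector p c) {i : Fin (stages p)} (h1 : 1 ≤ colev i)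
    (hi : Outer i) : c (ERK.ghost p (rk i)) = c i := by
  have hr := one_le_rk hi h1
  rw [hc.outer hi, hc.outer (ghost_outer hr (rk_le hi)), rk_ghost hr (rk_le hi)]

/-- A D-group stage and its ghost share a node, so the Q-conditions prescribe the same values of A
c^q in both rows. The difference is orthogonal to c^q, and `eq_zero_of_not_outer` applies. -/
theorem Solves.row_sub_mem_WD (hS : Solves p A b c) (hc : IsStageVector p c)
    {i : Fin (stages p)} (h1 : 1 ≤ colev i) (h2 : colev i + 2 ≤ nOf p) :
    A i - A (ghost p (rk i)) ∈ WD p (colev i + 2) := by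
  have hi : Outer i := outer_of_colev_lt (by omega)
  have hr := one_le_rk hi h1
  have hg := colev_ghost hr (rk_le hi)
  have hgo := ghost_outer hr (rk_le hi)
  have hlast : ∀ j, colev j = 0 → (A i - A (ghost p (rk i))) j = 0 := fun j hj => by
    rw [Pi.sub_apply, hS.last_column i hj, hS.last_column _ hj, sub_zero]
  have hout : ∀ j, Outer j → (A i - A (ghost p (rk i))) j = A i j := fun j hj => by
    rw [Pi.sub_apply, ghost_row_eq_zero hS.support hg.ge hj, sub_zero]
  have hcl : ∀ r, 1 ≤ r → r ≤ mOf p → ∑ j ∈ Cl p r, (A i - A (ghost p (rk i))) j = 0 := by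
    intro r hr1 hr2
    rw [← hS.row_cluster i h1 h2 r hr1 hr2]
    exact Finset.sum_congr rfl fun j hj => hout j (mem_Cl.1 hj).1
  refine mem_WD h2 (eq_zero_of_not_outer hc ?_ ?_ fun q _ =>
    sum_outer_mul_pow_eq_zero hc hlast hcl q) hlast ?_ hcl
  · intro j hj hjm
    rw [outer_iff] at hi hgo
    rw [Pi.sub_apply, hS.q_zero i j hj (by omega) hjm, hS.q_zero _ j hj (by omega) hjm, sub_zero]
  · intro q hq
    rw [outer_iff] at hgo
    have e1 := hS.q i q (by rw [outer_iff] at hi; omega) hq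
    have e2 := hS.q (ghost p (rk i)) q (by omega) hq
    rw [hc.ghost_eq h1 hi] at e2
    rw [sub_dotProduct, sub_eq_zero]
    exact e1.trans e2.symm
  · intro j hj1 hj2 hj3
    rw [hout j (outer_of_colev_lt hj3)]
    exact hS.row_zero i j h1 hj2 hj3

/-- Wherever b is nonzero, A c^q may be replaced by c^(q+1)/(q+1); what remains is an identity
between quadrature values. -/
theorem Solves.dVec_dotProduct_pow (hS : Solves p A b c) (hc : IsStageVector p c)
    (hb : IsWeightVector p c b) {k q : ℕ} (hk : k < nOf p) (hq : q < mOf p) :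
    dVec A b c k ⬝ᵥ c ^ q = 0 := by
  have hn := nOf_eq (p := p)
  have h1 : (b * c ^ k) ᵥ* A ⬝ᵥ c ^ q = 1 / ((q : ℝ) + 1) * (b ⬝ᵥ c ^ (k + q + 1)) := by
    rw [← dotProduct_mulVec, dotProduct, dotProduct, Finset.mul_sum]
    refine Finset.sum_congr rfl fun i _ => ?_
    rw [Pi.mul_apply, Pi.pow_apply, Pi.pow_apply]
    rcases Nat.eq_zero_or_pos (lev i) with h0 | h0
    · rw [hS.mulVec_first h0, hc.first_eq_zero h0, zero_pow (n := k + q + 1) (by omega)]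
      ring
    · by_cases hm : lev i < mOf p
      · rw [hb.eq_zero h0 hm]
        ring
      · rw [hS.q i q (by omega) hq]
        ring
  have h2 : (b * (1 - c ^ (k + 1))) ⬝ᵥ c ^ q = b ⬝ᵥ c ^ q - b ⬝ᵥ c ^ (k + q + 1) := by
    rw [mul_dotProduct, sub_mul, one_mul, ← pow_add, dotProduct_sub, add_right_comm]
  rw [dVec, sub_dotProduct, smul_dotProduct, h1, h2, hb.dotProduct_pow hc (by omega),
    hb.dotProduct_pow hc (by omega), smul_eq_mul]
  have e1 : ((q : ℝ) + 1) ≠ 0 := by positivity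
  have e2 : ((k : ℝ) + 1) ≠ 0 := by positivity
  have e3 : ((k : ℝ) + q + 1 + 1) ≠ 0 := by positivity
  push_cast
  field_simp
  ring

theorem Solves.dVec_mem_WD (hS : Solves p A b c) (hc : IsStageVector p c)
    (hb : IsWeightVector p c b) {k : ℕ} (hk : k < nOf p) : dVec A b c k ∈ WD p (k + 1) := by
  -- The last column of A is zero, and the last node is 1, so 1 - c^(k+1) vanishes there as well.
  have hlast : ∀ j, colev j = 0 → dVec A b c k j = 0 := fun j hj => by
    rw [dVec_apply, hc.last j (colev_eq_zero_iff.1 hj), lobattoNode_self two_le_NOf, one_pow,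
      sub_self, mul_zero, mul_zero, sub_zero]
    exact Finset.sum_eq_zero fun i _ => by rw [hS.last_column i hj, mul_zero]
  refine mem_WD hk (eq_zero_of_not_outer hc ?_
    (fun q hq => hS.dVec_dotProduct_pow hc hb hk hq) fun q _ =>
    sum_outer_mul_pow_eq_zero hc hlast (hS.d_cluster k hk) q) hlast
    (fun i _ h2 h3 => hS.d k hk i h2 h3) (hS.d_cluster k hk)
  intro j hj hjm
  rw [dVec_apply, hb.eq_zero hj (by omega), zero_mul, mul_zero, sub_zero]
  refine Finset.sum_eq_zero fun i _ => ?_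
  rcases Nat.eq_zero_or_pos (lev i) with h0 | h0
  · rw [hS.first_row h0, mul_zero]
  · by_cases hm : lev i < mOf p
    · rw [hb.eq_zero h0 hm, zero_mul, zero_mul]
    · rw [hS.q_zero i j hj (by omega) hjm, mul_zero]

theorem Solves.DSpace_le_WD (hS : Solves p A b c) (hc : IsStageVector p c)
    (hb : IsWeightVector p c b) {k : ℕ} (hk : k ≤ nOf p) : DSpace A b c k ≤ WD p k := by
  induction k with
  | zero => exact bot_le
  | succ k ih =>
    have ih := ih (by omega)
    have hmono : ∀ {a}, a ≤ k + 1 → WD p a ≤ WD p (k + 1) := fun {a} ha =>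
      (WD_le_iff (by omega) _).2 fun i h1 h2 => epsVec_mem_WD h1 (by omega) (by omega)
    refine Submodule.span_le.2 ?_
    rintro _ ((rfl | ⟨u, hu, rfl⟩) | ⟨u, hu, f, hf, rfl⟩)
    · exact hS.dVec_mem_WD hc hb hk
    · suffices h : WD p k ≤ (WD p (k + 1)).comap A.vecMulLinear from h (ih hu)
      rw [WD_le_iff (by omega)]
      intro i h1 h2
      rw [Submodule.mem_comap, vecMulLinear_apply, sub_single_vecMul]
      exact hmono (by omega) (hS.row_sub_mem_WD hc h1 (by omega))
    · suffices h : WD p k ≤ (WD p (k + 1)).comap (LinearMap.mulRight ℝ f) from h (ih hu)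
      rw [WD_le_iff (by omega)]
      intro i h1 h2
      obtain ⟨α, β, rfl⟩ := Submodule.mem_span_pair.1 hf
      have hi : Outer i := outer_of_colev_lt (by omega)
      -- Each generator lives on two stages with equal node, hence is an eigenvector of
      -- multiplication by any element of Φ_1.
      have h3 : (Pi.single i 1 - Pi.single (ghost p (rk i)) 1 : Fin (stages p) → ℝ) *
          (α • 1 + β • c) = (α + β * c i) • (Pi.single i 1 - Pi.single (ghost p (rk i)) 1) := by
        ext j
        have h4 := hc.ghost_eq h1 hi
        simp only [Pi.mul_apply, Pi.sub_apply, Pi.add_apply, Pi.smul_apply, Pi.one_apply,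
          smul_eq_mul, mul_one, Pi.single_apply]
        rcases eq_or_ne j i with rfl | hji
        · ring
        · rw [if_neg hji]
          split_ifs with h5
          · rw [h5, h4]; ring
          · ring
      rw [Submodule.mem_comap, LinearMap.mulRight_apply, h3]
      exact Submodule.smul_mem _ _ (epsVec_mem_WD h1 (by omega) (by omega))

/-- Vectors constant on clusters are orthogonal to `W_n^D`. -/
theorem WD_le_perp {v : Fin (stages p) → ℝ}
    (hv : ∀ i, 1 ≤ colev i → Outer i → v i = v (ghost p (rk i))) : WD p (nOf p) ≤ perp v := by
  rw [WD_le_iff le_rfl]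
  intro i h1 h2
  rw [mem_perp, sub_dotProduct, single_one_dotProduct, single_one_dotProduct, sub_eq_zero]
  exact hv i h1 (outer_of_colev_lt h2)

theorem WD_mem_VZero {d : Fin (stages p) → ℝ} (hd : d ∈ WD p (nOf p)) :
    d ∈ VZero (stages p) (lOf p) := by
  intro j hj
  rw [← dotProduct_single_one d j]
  refine (WD_le_perp fun i h1 hi => ?_) hd
  rw [Pi.single_apply, if_neg, Pi.single_apply, if_neg]
  · intro h
    have := ghost_outer (one_le_rk hi h1) (rk_le hi)
    rw [h, Outer] at this
    omega
  · rintro rfl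
    rw [Outer] at hi
    omega

theorem WD_clusterCondition (hc : IsStageVector p c) {d : Fin (stages p) → ℝ}
    (hd : d ∈ WD p (nOf p)) : ClusterCondition (lOf p) c d := by
  intro ξ
  have h : d ⬝ᵥ (fun i => if i ∈ cluster (lOf p) c ξ then 1 else 0) = 0 := by
    refine (WD_le_perp fun i h1 hi => ?_) hd
    have hg : lOf p + 2 ≤ stg (ghost p (rk i)) := ghost_outer (one_le_rk hi h1) (rk_le hi)
    have hi' : lOf p + 2 ≤ stg i := hi
    simp only [cluster, Finset.mem_filter, Finset.mem_univ, true_and, hg, hi']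
    rw [hc.ghost_eq h1 hi]
  simpa [dotProduct, Finset.sum_ite_mem] using h

/-! ### Verification of the sufficient conditions. -/

theorem Solves.sufficientConditions (hS : Solves p A b c) (hc : IsStageVector p c)
    (hb : IsWeightVector p c b) (hp2 : Even p) :
    SufficientConditions p (mOf p) (nOf p) A b c := by
  have hn := nOf_eq (p := p)
  have hp4 := hp.out
  have hpm : p = 2 * mOf p + 2 := by
    obtain ⟨t, rfl⟩ := hp2
    unfold mOf
    omega
  have hQ : ∀ q ∈ QSpace A c (mOf p), ∀ i, q i ≠ 0 → 1 ≤ lev i ∧ lev i < mOf p := by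
    intro q hq i hi
    by_contra h
    exact hi (hS.QSpace_le hc le_rfl hq i h)
  refine ⟨hn.le, by omega, ?_, ?_, ?_, ?_, ?_, ?_⟩
  · intro k h1 h2
    rw [hb.dotProduct_pow hc (by omega), Nat.cast_sub h1]
    simp
  · intro q hq
    ext i
    by_cases h : q i = 0
    · rw [Pi.mul_apply, h, mul_zero, Pi.zero_apply]
    · have := hQ q hq i h
      rw [Pi.mul_apply, hb.eq_zero this.1 this.2, zero_mul, Pi.zero_apply]
  -- Every power of c is constant on clusters, so `DO` holds for all exponents.
  · intro d hd k _ _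
    refine (WD_le_perp fun i h1 hi => ?_) (hS.DSpace_le_WD hc hb le_rfl hd)
    rw [Pi.pow_apply, Pi.pow_apply, hc.ghost_eq h1 hi]
  · intro q hq d hd
    ext i
    by_cases h : q i = 0
    · rw [Pi.mul_apply, h, zero_mul, Pi.zero_apply]
    · have h1 := hQ q hq i h
      have h2 : ¬ Outer i := by rw [outer_iff]; omega
      rw [Pi.mul_apply, WD_mem_VZero (hS.DSpace_le_WD hc hb le_rfl hd) i (by
        rw [Outer] at h2; omega), mul_zero, Pi.zero_apply]
  · rintro m₁ m₂ - h1 _ ⟨q, hq, q', -, rfl⟩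
    rw [hS.QSpace_eq hc h1] at hq ⊢
    intro i hi
    beta_reduce
    rw [Pi.mul_apply, hq i hi, zero_mul]
  · intro k hk
    rw [hS.QSpace_eq hc hk]
    refine Set.Subset.antisymm ?_ fun q hq => ?_
    · rintro _ ⟨q, hq, q', -, rfl⟩ i hi
      beta_reduce
      rw [Pi.mul_apply, hq i hi, zero_mul]
    -- The indicator of the levels 1,…,k-1 is a unit for the Hadamard product on Q_k.
    · refine ⟨q, hq, fun i => if 1 ≤ lev i ∧ lev i < k then 1 else 0, fun i hi => if_neg hi, ?_⟩
      ext i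
      beta_reduce
      rw [Pi.mul_apply]
      split_ifs with h
      · rw [mul_one]
      · rw [hq i h, zero_mul]

end Properties

/-! ### Existence and uniqueness -/

section Existence

variable {p : ℕ}

theorem not_outer_of_stg_eq_one {i : Fin (stages p)} (h : stg i = 1) : ¬ Outer i := by
  rw [Outer]
  omega

variable [hp : Fact (4 ≤ p)]
variable {A A' : Matrix (Fin (stages p)) (Fin (stages p)) ℝ} {b c : Fin (stages p) → ℝ}

theorem sum_Cl_eq {r : ℕ} (h1 : 1 ≤ r) (h2 : r ≤ mOf p) (f : Fin (stages p) → ℝ) :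
    ∑ j ∈ Cl p r, f j = f (ghost p r) + ∑ j ∈ Cl p r with colev j < nOf p, f j := by
  have hg := colev_ghost h1 h2
  have h3 : (Cl p r).filter (fun j => ¬ colev j < nOf p) = {ghost p r} := by
    ext j
    rw [Finset.mem_filter, Finset.mem_singleton, mem_Cl]
    constructor
    · rintro ⟨⟨ho, rfl⟩, h⟩
      exact eq_ghost ho (by have := colev_le ho; omega)
    · rintro rfl
      exact ⟨⟨ghost_outer h1 h2, rk_ghost h1 h2⟩, by omega⟩
  rw [← Finset.sum_filter_add_sum_filter_not _ (fun j => colev j < nOf p), h3,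
    Finset.sum_singleton, add_comm]

theorem one_le_colev_of_mem_Cl {r : ℕ} (h1 : 1 ≤ r) {j : Fin (stages p)} (hj : j ∈ Cl p r) :
    1 ≤ colev j := by
  by_contra h
  have h2 := (mem_Cl.1 (Cl_zero.2 (by omega : colev j = 0))).2
  rw [(mem_Cl.1 hj).2] at h2
  omega

/-- These rows carry all unknowns of the D-part, always multiplied by their weights. Ghost weights
may vanish. -/
theorem weight_ne_zero (hb : IsWeightVector p c b) (hbD : DGroupWeightsNonzero p b)
    {i : Fin (stages p)} (hi : colev i < nOf p) : b i ≠ 0 := by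
  rcases Nat.eq_zero_or_pos (colev i) with h | h
  · rw [hb.last i (colev_eq_zero_iff.1 h)]
    exact lobattoWeight_self_ne_zero three_le_NOf
  · have h1 := (le_colev_iff (i := i) (k := nOf p) (by omega)).not.1 (by omega)
    have h2 := (le_colev_iff (i := i) le_rfl).1 h
    have h3 := stages_eq (p := p)
    rw [tri_succ] at h3
    rw [tri_one] at h2
    exact hbD i (by rw [NOf_eq]; omega) (by omega)

theorem Solves.column_zero (hS : Solves p A b c) {i j : Fin (stages p)} (hj1 : 1 ≤ colev j)
    (hj2 : colev j < nOf p) (hi : i ∉ DNodes p (colev j)) : A i j = 0 := by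
  rw [DNodes, Finset.mem_filter] at hi
  have hi : ¬ (colev i = 0 ∨ colev i = colev j - 1) := fun h => hi ⟨Finset.mem_univ i, h⟩
  by_cases h : colev i < colev j
  · exact hS.row_zero i j (by omega) (by omega) hj2
  · have := outer_iff.1 (outer_of_colev_lt hj2)
    exact hS.support i j (by omega) (by omega)

theorem Solves.unique_D (hS : Solves p A b c) (hS' : Solves p A' b c) (hc : IsStageVector p c)
    (hb : IsWeightVector p c b) (hbD : DGroupWeightsNonzero p b) {j : Fin (stages p)}
    (hj1 : 1 ≤ colev j) (hj2 : colev j < nOf p) (i : Fin (stages p)) : A i j = A' i j := by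
  by_cases hi : i ∈ DNodes p (colev j)
  · have h1 := eq_zero_of_sum_mul_pow_eq_zero (DNodes p (colev j)) c
      (hc.injOn_DNodes hj1 hj2.le) (fun i => b i * (A i j - A' i j)) ?_ i hi
    · have h2 : colev i < nOf p := by
        rw [DNodes, Finset.mem_filter] at hi
        omega
      exact sub_eq_zero.1 ((mul_eq_zero.1 h1).resolve_left (weight_ne_zero hb hbD h2))
    · rw [card_DNodes hj1 hj2.le]
      intro k hk
      have e1 := hS.d k (by omega) j hk hj2
      have e2 := hS'.d k (by omega) j hk hj2
      rw [← e2, dVec_apply, dVec_apply, sub_left_inj] at e1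
      rw [← sub_eq_zero, ← Finset.sum_sub_distrib] at e1
      rw [← e1]
      refine (Finset.sum_subset (Finset.subset_univ _) fun i _ hi => ?_).trans
        (Finset.sum_congr rfl fun i _ => by ring)
      rw [hS.column_zero hj1 hj2 hi, hS'.column_zero hj1 hj2 hi]
      ring
  · rw [hS.column_zero hj1 hj2 hi, hS'.column_zero hj1 hj2 hi]

theorem Solves.cluster_row_zero (hS : Solves p A b c) {r : ℕ} (h1 : 1 ≤ r) (h2 : r ≤ mOf p)
    {i : Fin (stages p)} (hi : i ∉ DNodes p (nOf p)) : ∑ j ∈ Cl p r, A i j = 0 := by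
  rw [DNodes, Finset.mem_filter] at hi
  have hi : ¬ (colev i = 0 ∨ colev i = nOf p - 1) := fun h => hi ⟨Finset.mem_univ i, h⟩
  by_cases h : colev i < nOf p
  · exact hS.row_cluster i (by omega) (by omega) r h1 h2
  · exact Finset.sum_eq_zero fun j hj =>
      ghost_row_eq_zero hS.support (by omega) (mem_Cl.1 hj).1

/-- For a ghost column the equations see only cluster sums of columns. These sums are determined by
a Vandermonde system with n rows, and the D-group columns of the cluster are already known. -/
theorem Solves.unique_outer (hS : Solves p A b c) (hS' : Solves p A' b c)
    (hc : IsStageVector p c) (hb : IsWeightVector p c b) (hbD : DGroupWeightsNonzero p b)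
    {j : Fin (stages p)} (hj : Outer j) (i : Fin (stages p)) : A i j = A' i j := by
  have hn := nOf_eq (p := p)
  rcases Nat.eq_zero_or_pos (colev j) with h0 | h0
  · rw [hS.last_column i h0, hS'.last_column i h0]
  rcases (colev_le hj).lt_or_eq with h | h
  · exact hS.unique_D hS' hc hb hbD h0 h i
  have hr1 := one_le_rk hj h0
  have hr2 := rk_le hj
  have hT : ∑ j' ∈ Cl p (rk j), (A i j' - A' i j') = 0 := by
    by_cases hi : i ∈ DNodes p (nOf p)
    · have h1 := eq_zero_of_sum_mul_pow_eq_zero (DNodes p (nOf p)) c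
        (hc.injOn_DNodes (by omega) le_rfl)
        (fun i => b i * ∑ j' ∈ Cl p (rk j), (A i j' - A' i j')) ?_ i hi
      · have h2 : colev i < nOf p := by
          rw [DNodes, Finset.mem_filter] at hi
          omega
        exact (mul_eq_zero.1 h1).resolve_left (weight_ne_zero hb hbD h2)
      · rw [card_DNodes (by omega) le_rfl]
        intro k hk
        have e1 := hS.d_cluster k hk _ hr1 hr2
        have e2 := hS'.d_cluster k hk _ hr1 hr2
        simp only [dVec_apply, Finset.sum_sub_distrib] at e1 e2
        rw [← e2, sub_left_inj, ← sub_eq_zero, Finset.sum_comm,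
          Finset.sum_comm (s := Cl p (rk j)), ← Finset.sum_sub_distrib] at e1
        rw [← e1]
        refine (Finset.sum_subset (Finset.subset_univ _) fun i _ hi => ?_).trans
          (Finset.sum_congr rfl fun i _ => ?_)
        · rw [Finset.sum_sub_distrib, hS.cluster_row_zero hr1 hr2 hi,
            hS'.cluster_row_zero hr1 hr2 hi]
          ring
        · rw [← Finset.mul_sum, ← Finset.mul_sum, Finset.sum_sub_distrib]
          ring
    · rw [Finset.sum_sub_distrib, hS.cluster_row_zero hr1 hr2 hi,
        hS'.cluster_row_zero hr1 hr2 hi, sub_zero]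
  rw [sum_Cl_eq hr1 hr2, ← eq_ghost hj h, Finset.sum_eq_zero, add_zero, sub_eq_zero] at hT
  · exact hT
  · intro j' hj'
    rw [Finset.mem_filter] at hj'
    rw [hS.unique_D hS' hc hb hbD (one_le_colev_of_mem_Cl hr1 hj'.1) hj'.2, sub_self]

theorem Solves.unique (hS : Solves p A b c) (hS' : Solves p A' b c) (hc : IsStageVector p c)
    (hb : IsWeightVector p c b) (hbD : DGroupWeightsNonzero p b) : A = A' := by
  have hm := one_le_mOf (p := p)
  ext i j
  by_cases hj : Outer j
  · exact hS.unique_outer hS' hc hb hbD hj i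
  rcases Nat.eq_zero_or_pos (lev i) with hi | hi
  · rw [hS.first_row hi, hS'.first_row hi]
  -- The Q-conditions for row i hold for exponents below both its level and m. Outer rows all behave
  -- like level m.
  set g := min (lev i) (mOf p) with hg
  have hz : ∀ j, j ∉ QNodes p g → A i j - A' i j = 0 := by
    intro j hj
    by_cases ho : Outer j
    · rw [hS.unique_outer hS' hc hb hbD ho i, sub_self]
    · rw [QNodes, Finset.mem_filter] at hj
      have hj : ¬ (lev j = 0 ∨ lev j = g - 1) := fun h => hj ⟨Finset.mem_univ j, h⟩
      have ho' := outer_iff.not.1 ho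
      by_cases h : lev j + 2 ≤ g
      · rw [hS.q_zero i j (by omega) (by omega) (by omega),
          hS'.q_zero i j (by omega) (by omega) (by omega), sub_self]
      · rw [hS.support i j (fun h => ho h.1) (by omega),
          hS'.support i j (fun h => ho h.1) (by omega), sub_self]
  by_cases hj' : j ∈ QNodes p g
  · refine sub_eq_zero.1 (eq_zero_of_sum_mul_pow_eq_zero (QNodes p g) c
      (hc.injOn_QNodes (by omega)) (fun j => A i j - A' i j) ?_ j hj')
    rw [card_QNodes (by omega) (by omega)]
    intro k hk
    have e1 := (hS.q i k (by omega) (by omega)).trans (hS'.q i k (by omega) (by omega)).symm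
    rw [← sub_eq_zero] at e1
    simp only [mulVec, dotProduct] at e1
    rw [← Finset.sum_sub_distrib] at e1
    rw [← e1]
    refine (Finset.sum_subset (Finset.subset_univ _) fun j _ hj => ?_).trans
      (Finset.sum_congr rfl fun j _ => ?_)
    · rw [hz j hj, zero_mul]
    · rw [Pi.pow_apply]
      ring
  · exact sub_eq_zero.1 (hz j hj')

/-- A solution of the `D`-system supported on the outer columns. -/
theorem exists_outer_part (hc : IsStageVector p c) (hb0 : ∀ i, colev i < nOf p → b i ≠ 0)
    (ρ : ℕ → Fin (stages p) → ℝ) :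
    ∃ M : Matrix (Fin (stages p)) (Fin (stages p)) ℝ,
      (∀ i j, ¬ (Outer j ∧ colev i < nOf p ∧ colev i < colev j) → M i j = 0) ∧
      (∀ k j, k + 1 ≤ colev j → colev j < nOf p → ∑ i, b i * c i ^ k * M i j = ρ k j) ∧
      (∀ k < nOf p, ∀ r, 1 ≤ r → r ≤ mOf p →
        ∑ j ∈ Cl p r, ∑ i, b i * c i ^ k * M i j = ∑ j ∈ Cl p r, ρ k j) ∧
      (∀ i j, 1 ≤ colev i → colev i + 2 ≤ colev j → colev j < nOf p → M i j = 0) ∧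
      ∀ i, 1 ≤ colev i → colev i + 2 ≤ nOf p → ∀ r, 1 ≤ r → r ≤ mOf p →
        ∑ j ∈ Cl p r, M i j = 0 := by
  have hn := nOf_eq (p := p)
  have h1 : ∀ j : Fin (stages p), ∃ a : Fin (stages p) → ℝ, 1 ≤ colev j → colev j < nOf p →
      (∀ i ∉ DNodes p (colev j), a i = 0) ∧
        ∀ k < colev j, ∑ i ∈ DNodes p (colev j), a i * c i ^ k = ρ k j := by
    intro j
    by_cases hj : 1 ≤ colev j ∧ colev j < nOf p
    · obtain ⟨a, ha⟩ := exists_sum_mul_pow_eq (DNodes p (colev j)) c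
        (hc.injOn_DNodes hj.1 hj.2.le) (fun k => ρ k j)
      rw [card_DNodes hj.1 hj.2.le] at ha
      exact ⟨a, fun _ _ => ha⟩
    · exact ⟨0, fun h h' => absurd ⟨h, h'⟩ hj⟩
  choose a ha using h1
  -- Here t is the weighted sum of the columns in cluster r, prescribed independently of the D-group
  -- columns; the ghost column of M makes up the difference.
  have h2 : ∀ r : ℕ, ∃ t : Fin (stages p) → ℝ, (∀ i ∉ DNodes p (nOf p), t i = 0) ∧
      ∀ k < nOf p, ∑ i ∈ DNodes p (nOf p), t i * c i ^ k = ∑ j ∈ Cl p r, ρ k j := by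
    intro r
    have := exists_sum_mul_pow_eq (DNodes p (nOf p)) c
      (hc.injOn_DNodes (by omega) le_rfl) (fun k => ∑ j ∈ Cl p r, ρ k j)
    rwa [card_DNodes (by omega) le_rfl] at this
  choose t ht using h2
  have hmem : ∀ g (i : Fin (stages p)), i ∈ DNodes p g ↔ colev i = 0 ∨ colev i = g - 1 :=
    fun g i => by simp [DNodes]
  have ha0 : ∀ i j, 1 ≤ colev j → colev j < nOf p → ¬ (colev i = 0 ∨ colev i = colev j - 1) →
      a j i = 0 := fun i j hj1 hj2 h => (ha j hj1 hj2).1 i (by rwa [hmem])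
  have ht0 : ∀ i r, ¬ (colev i = 0 ∨ colev i = nOf p - 1) → t r i = 0 :=
    fun i r h => (ht r).1 i (by rwa [hmem])
  let M : Matrix (Fin (stages p)) (Fin (stages p)) ℝ := fun i j =>
    if ¬ Outer j ∨ colev j = 0 then 0 else
      if colev j < nOf p then a j i / b i else
        t (rk j) i / b i - ∑ j' ∈ Cl p (rk j) with colev j' < nOf p, a j' i / b i
  have hMD : ∀ i j, 1 ≤ colev j → colev j < nOf p → M i j = a j i / b i := by
    intro i j hj1 hj2
    have ho : Outer j := outer_of_colev_lt hj2
    simp only [M]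
    rw [if_neg (by omega), if_pos hj2]
  have hMcl : ∀ i r, 1 ≤ r → r ≤ mOf p → ∑ j ∈ Cl p r, M i j = t r i / b i := by
    intro i r hr1 hr2
    have hg := colev_ghost hr1 hr2
    have ho := ghost_outer hr1 hr2
    rw [sum_Cl_eq hr1 hr2, Finset.sum_congr rfl (g := fun j' => a j' i / b i)]
    · simp only [M]
      rw [if_neg (by omega), if_neg (by omega), rk_ghost hr1 hr2, sub_add_cancel]
    · intro j hj
      rw [Finset.mem_filter] at hj
      exact hMD i j (one_le_colev_of_mem_Cl hr1 hj.1) hj.2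
  have hred : ∀ (g k : ℕ) (u : Fin (stages p) → ℝ), 1 ≤ g → g ≤ nOf p →
      (∀ i ∉ DNodes p g, u i = 0) →
      ∑ i, b i * c i ^ k * (u i / b i) = ∑ i ∈ DNodes p g, u i * c i ^ k := by
    intro g k u hg1 hg2 hu
    rw [← Finset.sum_subset (Finset.subset_univ (DNodes p g))]
    · refine Finset.sum_congr rfl fun i hi => ?_
      rw [hmem] at hi
      have := hb0 i (by omega)
      field_simp
    · intro i _ hi
      rw [hu i hi, zero_div, mul_zero]
  refine ⟨M, ?_, ?_, ?_, ?_, ?_⟩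
  · intro i j hij
    simp only [M]
    split_ifs with h3 h4
    · rfl
    · rw [ha0 i j (by omega) h4 (by omega), zero_div]
    · have h5 : colev j = nOf p := by
        have := colev_le (not_not.1 (not_or.1 h3).1)
        omega
      rw [ht0 i _ (by omega), zero_div, zero_sub, neg_eq_zero]
      refine Finset.sum_eq_zero fun j' hj' => ?_
      rw [Finset.mem_filter] at hj'
      have h6 := one_le_colev_of_mem_Cl (one_le_rk (by omega) (by omega)) hj'.1
      rw [ha0 i j' h6 hj'.2 (by omega), zero_div]
  · intro k j hk hj
    have h3 := ha j (by omega) hj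
    rw [← h3.2 k hk, ← hred (colev j) k (a j) (by omega) hj.le h3.1]
    exact Finset.sum_congr rfl fun i _ => by rw [hMD i j (by omega) hj]
  · intro k hk r hr1 hr2
    rw [← (ht r).2 k hk, ← hred (nOf p) k (t r) (by omega) le_rfl (ht r).1, Finset.sum_comm]
    exact Finset.sum_congr rfl fun i _ => by rw [← Finset.mul_sum, hMcl i r hr1 hr2]
  · intro i j hi hij hj
    rw [hMD i j (by omega) hj, ha0 i j (by omega) hj (by omega), zero_div]
  · intro i hi hin r hr1 hr2
    rw [hMcl i r hr1 hr2, ht0 i r (by omega), zero_div]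

/-- The D-conditions involve only outer columns, which the Q-part leaves untouched. So the outer
part is built first and its contribution moved to the right-hand side of the Q-conditions. -/
theorem exists_solves (hc : IsStageVector p c) (hb : IsWeightVector p c b)
    (hbD : DGroupWeightsNonzero p b) : ∃ A, Solves p A b c := by
  obtain ⟨M, hM0, hMd, hMcl, hMz, hMr⟩ := exists_outer_part hc
    (fun i hi => weight_ne_zero hb hbD hi)
    (fun k j => 1 / ((k : ℝ) + 1) * (b j * (1 - c j ^ (k + 1))))
  have hm := one_le_mOf (p := p)
  have h1 : ∀ i : Fin (stages p), ∃ a : Fin (stages p) → ℝ,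
      (∀ j, ¬ (1 ≤ lev i ∧ (lev j = 0 ∨ lev j = min (lev i) (mOf p) - 1)) → a j = 0) ∧
      ∀ q < lev i, q < mOf p →
        ∑ j, a j * c j ^ q = 1 / ((q : ℝ) + 1) * c i ^ (q + 1) - ∑ j, M i j * c j ^ q := by
    intro i
    rcases Nat.eq_zero_or_pos (lev i) with hi | hi
    · exact ⟨0, fun _ _ => rfl, fun q hq => by omega⟩
    set g := min (lev i) (mOf p) with hg
    have hmem : ∀ j, j ∈ QNodes p g ↔ lev j = 0 ∨ lev j = g - 1 := fun j => by simp [QNodes]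
    obtain ⟨a, ha1, ha2⟩ := exists_sum_mul_pow_eq (QNodes p g) c (hc.injOn_QNodes (by omega))
      (fun q => 1 / ((q : ℝ) + 1) * c i ^ (q + 1) - ∑ j, M i j * c j ^ q)
    rw [card_QNodes (by omega) (by omega)] at ha2
    refine ⟨a, fun j hj => ha1 j (by rw [hmem]; exact fun h => hj ⟨hi, h⟩), fun q hq hqm => ?_⟩
    rw [← ha2 q (by omega)]
    exact (Finset.sum_subset (Finset.subset_univ _) fun j _ hj => by
      rw [ha1 j hj, zero_mul]).symm
  choose a ha0 ha using h1
  have haO : ∀ i j, Outer j → a i j = 0 := by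
    intro i j hj
    rw [outer_iff] at hj
    exact ha0 i j (by omega)
  have hO : ∀ i j, Outer j → (M + Matrix.of a) i j = M i j := by
    intro i j hj
    rw [Matrix.add_apply, Matrix.of_apply, haO i j hj, add_zero]
  have hd : ∀ k j, Outer j → dVec (M + Matrix.of a) b c k j =
      ∑ i, b i * c i ^ k * M i j - 1 / ((k : ℝ) + 1) * (b j * (1 - c j ^ (k + 1))) := by
    intro k j hj
    rw [dVec_apply]
    congr 1
    exact Finset.sum_congr rfl fun i _ => by rw [hO i j hj]
  refine ⟨M + Matrix.of a, ?_, ?_, ?_, ?_, ?_, ?_, ?_⟩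
  · intro i j hD hQ
    rw [Matrix.add_apply, Matrix.of_apply, hM0 i j hD, ha0 i j (by omega), add_zero]
  · intro i k hk hkm
    have h2 := ha i k hk hkm
    rw [eq_sub_iff_add_eq] at h2
    rw [← h2, add_mulVec, Pi.add_apply, add_comm]
    rfl
  · intro i j hj hij hjm
    rw [Matrix.add_apply, Matrix.of_apply, hM0 i j (by rw [outer_iff]; omega),
      ha0 i j (by omega), add_zero]
  · intro k _ j hkj hj
    rw [hd k j (outer_of_colev_lt hj), hMd k j hkj hj, sub_self]
  · intro k hk r hr1 hr2
    rw [Finset.sum_congr rfl fun j hj => hd k j (mem_Cl.1 hj).1, Finset.sum_sub_distrib,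
      hMcl k hk r hr1 hr2, sub_self]
  · intro i j hi hij hj
    rw [hO i j (outer_of_colev_lt hj), hMz i j hi hij hj]
  · intro i hi hin r hr1 hr2
    rw [← hMr i hi hin r hr1 hr2]
    exact Finset.sum_congr rfl fun j hj => hO i j (mem_Cl.1 hj).1

theorem existsUnique_isConstructed (hc : IsStageVector p c) (hb : IsWeightVector p c b)
    (hbD : DGroupWeightsNonzero p b) : ∃! A, IsConstructed p A b c := by
  obtain ⟨A, hA⟩ := exists_solves hc hb hbD
  exact ⟨A, isConstructed_iff.2 hA, fun A' hA' => (isConstructed_iff.1 hA').unique hA hc hb hbD⟩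

/-! ### Admissible nodes and weights -/

theorem exists_isStageVector (p : ℕ) [Fact (4 ≤ p)] : ∃ c, IsStageVector p c := by
  have hn := nOf_eq (p := p)
  have hN := NOf_eq (p := p)
  -- The stage number itself serves as a free node: it is nonzero and injective.
  refine ⟨fun i => if Outer i then lobattoNode (NOf p) (NOf p - rk i) else
    if stg i = 1 then lobattoNode (NOf p) 1 else stg i, ?_, ?_, ?_, ?_, ?_, ?_⟩
  · intro i hi
    rw [if_neg (not_outer_of_stg_eq_one hi), if_pos hi]
  · intro i hi
    have h0 := colev_eq_zero_iff.2 hi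
    have ho := (mem_Cl.1 (Cl_zero.2 h0))
    rw [if_pos ho.1, ho.2, Nat.sub_zero]
  · intro i r h1 h2 hi
    obtain ⟨e1, e2, -, e4⟩ := ghostPos_spec (p := p) h1 (by omega)
    obtain rfl : i = stageAt p (ghostPos p r) := stg_injective (hi.trans e1.symm)
    rw [if_pos e2, e4]
  · intro i j r h1 h2 h3 hi
    obtain ⟨e1, e2, -, e4⟩ := dPos_spec (p := p) h1 h2 (by omega)
    obtain rfl : i = stageAt p (dPos p j r) := stg_injective (hi.trans e1.symm)
    rw [if_pos e2, e4]
  · intro g i h1 h2 hi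
    rw [InQGroup_iff h1] at hi
    have h3 := lev_eq_zero_iff (i := i)
    have hm := one_le_mOf (p := p)
    rw [if_neg (by rw [outer_iff]; omega), if_neg (by omega)]
    have := one_le_stg i
    positivity
  · intro g i j h1 h2 hi hj hij
    rw [InQGroup_iff h1] at hi hj
    have h3 := lev_eq_zero_iff (i := i)
    have h4 := lev_eq_zero_iff (i := j)
    have hm := one_le_mOf (p := p)
    rw [if_neg (by rw [outer_iff]; omega), if_neg (by omega), if_neg (by rw [outer_iff]; omega),
      if_neg (by omega)]
    exact fun h => hij (stg_injective (by exact_mod_cast h))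

theorem exists_isWeightVector (hc : IsStageVector p c) :
    ∃ b, IsWeightVector p c b ∧ DGroupWeightsNonzero p b := by
  have hn := nOf_eq (p := p)
  have hN := NOf_eq (p := p)
  have hm := one_le_mOf (p := p)
  have hs := stages_eq (p := p)
  -- All D-group weights are 1, and each ghost weight absorbs the remainder needed for its cluster
  -- sum.
  refine ⟨fun i => if stg i = 1 then lobattoWeight (NOf p) 1 else if ¬ Outer i then 0 else
    if colev i = 0 then lobattoWeight (NOf p) (NOf p) else if colev i < nOf p then 1 else
      lobattoWeight (NOf p) (NOf p - rk i) - ∑ j ∈ Cl p (rk i) with colev j < nOf p, (1 : ℝ),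
    ⟨?_, ?_, ?_, ?_⟩, ?_⟩
  · intro i h1 h2
    beta_reduce
    rw [if_neg (by omega), if_pos (by rw [Outer]; omega)]
  · intro i hi
    rw [if_pos hi]
  · intro i hi
    have h0 := colev_eq_zero_iff.2 hi
    have ho := (mem_Cl.1 (Cl_zero.2 h0)).1
    rw [if_neg fun h => not_outer_of_stg_eq_one h ho, if_neg (not_not.2 ho), if_pos h0]
  · intro j hj1 hj2
    obtain ⟨r, hr1, hr2, rfl⟩ : ∃ r, 1 ≤ r ∧ r ≤ mOf p ∧ j = NOf p - r :=
      ⟨NOf p - j, by omega, by omega, by omega⟩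
    have ho := ghost_outer hr1 hr2
    have hg := colev_ghost hr1 hr2
    rw [hc.cluster_eq hr2, sum_Cl_eq hr1 hr2, if_neg fun h => not_outer_of_stg_eq_one h ho,
      if_neg (not_not.2 ho), if_neg (by omega), if_neg (by omega), rk_ghost hr1 hr2,
      sub_add_eq_add_sub, sub_eq_iff_eq_add, add_right_inj]
    refine Finset.sum_congr rfl fun i hi => ?_
    rw [Finset.mem_filter] at hi
    have ho' := (mem_Cl.1 hi.1).1
    have h0 := one_le_colev_of_mem_Cl hr1 hi.1
    rw [if_neg fun h => not_outer_of_stg_eq_one h ho', if_neg (not_not.2 ho'),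
      if_neg (by omega), if_pos hi.2]
  · intro i h1 h2
    have h3 := le_colev_iff (i := i) (k := nOf p) (by omega)
    have h4 := le_colev_iff (i := i) le_rfl
    rw [tri_succ] at hs
    rw [tri_one] at h4
    have ho : Outer i := outer_of_colev_lt (by omega)
    beta_reduce
    rw [if_neg fun h => not_outer_of_stg_eq_one h ho, if_neg (not_not.2 ho), if_neg (by omega),
      if_pos (by omega)]
    exact one_ne_zero

theorem stages_eq_div (hp2 : Even p) :
    (stages p : ℝ) = ((p : ℝ) ^ 2 - 2 * (p : ℝ) + 8) / 4 := by
  obtain ⟨t, ht⟩ := hp2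
  have hn := nOf_eq (p := p)
  have ht' : p = 2 * mOf p + 2 := by
    have := hp.out
    unfold mOf
    omega
  have htri : ∀ k, (tri k : ℝ) = k * (k - 1) / 2 := by
    intro k
    induction k with
    | zero => simp [tri_zero]
    | succ k ih => rw [tri_succ]; push_cast; rw [ih]; ring
  have h1 : (p : ℝ) = 2 * mOf p + 2 := by exact_mod_cast ht'
  rw [stages_eq, lOf_eq, hn]
  push_cast
  rw [htri, htri, h1]
  push_cast
  ring

end Existence

end ERK

/-! ### Assembly of the theorem. -/

theorem mainTheorem3 (p : ℕ) (hp : Even p) (hp4 : 4 ≤ p) :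
    -- the number of stages
    (ERK.stages p : ℝ) = ((p : ℝ) ^ 2 - 2 * (p : ℝ) + 8) / 4 ∧
    -- admissible nodes and weights exist
    (∃ c b : Fin (ERK.stages p) → ℝ, ERK.IsStageVector p c ∧ ERK.IsWeightVector p c b ∧
      ERK.DGroupWeightsNonzero p b) ∧
    ∀ c b : Fin (ERK.stages p) → ℝ, ERK.IsStageVector p c → ERK.IsWeightVector p c b →
      -- the construction produces exactly one matrix
      (ERK.DGroupWeightsNonzero p b →
        ∃! A : Matrix (Fin (ERK.stages p)) (Fin (ERK.stages p)) ℝ, ERK.IsConstructed p A b c) ∧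
      -- every matrix it produces has the asserted properties
      ∀ A : Matrix (Fin (ERK.stages p)) (Fin (ERK.stages p)) ℝ, ERK.IsConstructed p A b c →
        ERK.IsExplicitTableau A c ∧
        Module.finrank ℝ (ERK.QSpace A c (ERK.mOf p)) = ERK.lOf p ∧
        (∀ q ∈ ERK.QSpace A c (ERK.mOf p), q ∈ ERK.VStar (ERK.stages p) (ERK.lOf p)) ∧
        (∀ d ∈ ERK.DSpace A b c (ERK.nOf p),
          d ∈ ERK.VZero (ERK.stages p) (ERK.lOf p) ∧ ERK.ClusterCondition (ERK.lOf p) c d) ∧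
        ERK.SufficientConditions p (ERK.mOf p) (ERK.nOf p) A b c ∧
        ERK.HasOrder p A b := by
  have := Fact.mk hp4
  refine ⟨ERK.stages_eq_div hp, ?_, fun c b hc hb => ⟨fun hbD =>
    ERK.existsUnique_isConstructed hc hb hbD, fun A hA => ?_⟩⟩
  · obtain ⟨c, hc⟩ := ERK.exists_isStageVector p
    obtain ⟨b, hb, hbD⟩ := ERK.exists_isWeightVector hc
    exact ⟨c, b, hc, hb, hbD⟩
  · have hS := ERK.isConstructed_iff.1 hA
    have hsc := hS.sufficientConditions hc hb hp
    have hQ := hS.QSpace_eq hc le_rfl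
    have hD := hS.DSpace_le_WD hc hb le_rfl
    refine ⟨hS.isExplicitTableau hc, ?_, fun q hq i hi => ?_, fun d hd =>
      ⟨ERK.WD_mem_VZero (hD hd), ERK.WD_clusterCondition hc (hD hd)⟩, hsc,
      hsc.hasOrder (by unfold ERK.nOf; omega)⟩
    · rw [hQ, ERK.finrank_levelSpace]
    · rw [hQ] at hq
      refine hq i ?_
      have h1 := ERK.lev_eq_zero_iff (i := i)
      have h2 := ERK.outer_iff (i := i)
      unfold ERK.Outer at h2
      omega
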